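/- **Setting.** A seller faces a buyer for $T$ steps. At step $t$ the buyer has a value $v_t\in[0,1]$, the seller posts a price $p_t\in[0,1]$ and sees only $\sigma_t=\mathbf 1\{p_t\le v_t\}$ (whether the item is sold). The revenue loss is $\frac1T\sum_{t=1}^T (v_t-p_t\sigma_t)$. An online algorithm chooses $p_t$ from $\sigma_1,\dots,\sigma_{t-1}$ and possibly independent internal randomness. For $\epsilon\in(0,1]$, a stochastic buyer with changing rate $\epsilon$ is a process $(v_t)$ with values in $[0,1]$ that is a martingale with respect to some filtration and satisfies $|v_{t+1}-v_t|\le\epsilon$ almost surely. The seller knows $\epsilon$. **Algorithm $\mathcal A_\epsilon$.** Start with the confidence interval $[\ell,r]=[0,1]$. Time is divided into phases of length $m=\lceil\epsilon^{-2/3}\rceil$. In each phase, first run a binary search: as long as $r-\ell>6\epsilon$, post $p=\frac{\ell+r}2$ and replace $[\ell,r]$ by $[\max(0,p-\epsilon),\min(1,r+\epsilon)]$ if the item is sold and by $[\max(0,\ell-\epsilon),\min(1,p+\epsilon)]$ otherwise. Once $r-\ell\le 6\epsilon$, let $\ell_*$ be the current $\ell$ and post the price $\max\{0,\ \ell_*-4\epsilon^{2/3}\sqrt{\log(1/\epsilon)}\}$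 in all remaining steps of the phase; in each of these steps the confidence interval is replaced by $[\max(0,\ell-\epsilon),\min(1,r+\epsilon)]$. The next phase starts its search from the current confidence interval. **Theorem.** (1) $\mathcal A_\epsilon$ has expected revenue loss $\tilde O(\epsilon^{2/3})$, in the following sense. There are constants $C>0$, $k\in\mathbb N$ and a function $g$ with $g(T)\to0$ as $T\to\infty$ such that for all $\epsilon\in(0,1]$, all $T\ge1$ and every stochastic buyer with changing rate $\epsilon$, the expected revenue loss of $\mathcal A_\epsilon$ over $T$ steps is at most $$C\,(1+\log\tfrac1\epsilon)^k\,\bigl(\epsilon^{2/3}+\tfrac1T\bigr),$$ and that of $\mathcal A_{\max(\epsilon,1/T)}$ is at most $$C\,(1+\log\tfrac1\epsilon)^k\,\epsilon^{2/3}+g(T).$$ (2) No online algorithm has revenue loss less than $\Omega(\epsilon^{2/3})$, already against a random walk. For every $K>0$ there are $c,\epsilon_0>0$ such that for every $\epsilon\in(0,\epsilon_0]$ the unbiased random walk with step size $\epsilon$, started at $v_1=\frac12$ and stopped when its next step could leave $[0,1]$, is a stochastic buyer with changing rate $\epsilon$, and for every $T$ with $\epsilon^{-2/3}\le T\le K\epsilon^{-2}$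 every (possibly randomized) online algorithm has expected revenue loss at least $c\,\epsilon^{2/3}$ against it. -/

import Mathlib

open MeasureTheory Filter Topology

noncomputable section

namespace DynamicPricing

/-- A deterministic online pricing strategy of the seller: it maps the list of the sale signals seen
so far (most recent first, `true` = the item was sold) to the next price, which lies in `[0, 1]`.
The time step is one more than the length of the list, and the earlier prices are determined by the
strategy and the list. -/
def Seller : Type := List Bool → Set.Icc (0 : ℝ) 1

/-- The signals observed in the first `t` steps when the buyer's values are `v 0, v 1, …`:
the buyer buys if and only if the posted price is at most the current value. -/
def signals (A : Seller) (v : ℕ → ℝ) : ℕ → List Bool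
  | 0 => []
  | t + 1 => decide ((A (signals A v t) : ℝ) ≤ v t) :: signals A v t

/-- The price posted at step `t` (steps are numbered `0, …, T - 1`). -/
def priceAt (A : Seller) (v : ℕ → ℝ) (t : ℕ) : ℝ := A (signals A v t)

/-- The revenue collected at step `t`. -/
def revenueAt (A : Seller) (v : ℕ → ℝ) (t : ℕ) : ℝ :=
  if priceAt A v t ≤ v t then priceAt A v t else 0

/-- The (average) revenue loss over the horizon `T`. -/
def revenueLoss (A : Seller) (v : ℕ → ℝ) (T : ℕ) : ℝ :=
  (1 / (T : ℝ)) * ∑ t ∈ Finset.range T, (v t - revenueAt A v t)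

/-- A stochastic buyer with fixed changing rate `ε`: the values lie in `[0, 1]`, form a martingale
with respect to the filtration `ℱ` (the information available to the adversary), and change by at
most `ε` per step. Against a deterministic seller the posted prices are functions of the past
values, so an adversary that adaptively chooses mean-zero step distributions supported in `[-ε, ε]`
produces exactly such processes. -/
structure IsStochasticBuyer {Ω : Type*} {mΩ : MeasurableSpace Ω} (P : Measure Ω)
    (ℱ : Filtration ℕ mΩ) (ε : ℝ) (v : ℕ → Ω → ℝ) : Prop where
  mem_Icc : ∀ t, ∀ᵐ ω ∂P, v t ω ∈ Set.Icc (0 : ℝ) 1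
  martingale : Martingale v ℱ P
  step_le : ∀ t, ∀ᵐ ω ∂P, |v (t + 1) ω - v t ω| ≤ ε

/-! ### The algorithm -/

/-- The length of a phase, `ε ^ (-2/3)` rounded up. -/
def phaseLength (ε : ℝ) : ℕ := ⌈ε ^ (-(2 / 3) : ℝ)⌉₊

/-- The safety margin `4 ε ^ (2/3) √(log (1/ε))`. -/
def margin (ε : ℝ) : ℝ := 4 * ε ^ (2 / 3 : ℝ) * √(Real.log (1 / ε))

/-- The state of the algorithm before a step. -/
structure AlgState where
  /-- the number of steps of the current phase that are over -/
  pos : ℕ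
  /-- lower end of the current confidence interval -/
  lo : ℝ
  /-- upper end of the current confidence interval -/
  hi : ℝ
  /-- `some ℓ` once the binary search of the current phase has ended with lower end `ℓ` -/
  anchor : Option ℝ

/-- The lower end `ℓ` that fixes the price of this step, or `none` if the binary search of the
current phase still goes on; the search ends as soon as the confidence interval has length at
most `6 ε`. -/
def AlgState.base (ε : ℝ) (s : AlgState) : Option ℝ :=
  match s.anchor with
  | some l => some l
  | none => if s.hi - s.lo ≤ 6 * ε then some s.lo else none

/-- The price: the midpoint during the search, then `ℓ - 4 ε ^ (2/3) √(log (1/ε))`. -/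
def AlgState.price (ε : ℝ) (s : AlgState) : ℝ :=
  match s.base ε with
  | none => (s.lo + s.hi) / 2
  | some l => l - margin ε

/-- The confidence interval for the next value: during the search the interval is cut at the
midpoint according to the signal; in every step it is widened by `ε` on both sides, within
`[0, 1]`. -/
def AlgState.nextInterval (ε : ℝ) (s : AlgState) (sold : Bool) : ℝ × ℝ :=
  match s.base ε with
  | none =>
    if sold then (max 0 ((s.lo + s.hi) / 2 - ε), min 1 (s.hi + ε))
    else (max 0 (s.lo - ε), min 1 ((s.lo + s.hi) / 2 + ε))
  | some _ => (max 0 (s.lo - ε), min 1 (s.hi + ε))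

/-- One step of the algorithm; after `phaseLength ε` steps a new phase begins, with a new search
that starts from the current confidence interval. -/
def AlgState.next (ε : ℝ) (s : AlgState) (sold : Bool) : AlgState where
  pos := if s.pos + 1 < phaseLength ε then s.pos + 1 else 0
  lo := (s.nextInterval ε sold).1
  hi := (s.nextInterval ε sold).2
  anchor := if s.pos + 1 < phaseLength ε then s.base ε else none

/-- The state after a list of signals (most recent first); initially the interval is `[0, 1]`. -/
def algState (ε : ℝ) : List Bool → AlgState
  | [] => ⟨0, 0, 1, none⟩
  | sold :: h => (algState ε h).next ε sold

/-- The phase algorithm for a stochastic buyer with known changing rate `ε`. Prices are clipped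
to `[0, 1]`; this only matters when `ℓ - 4 ε ^ (2/3) √(log (1/ε))` is negative. -/
def phaseAlgorithm (ε : ℝ) : Seller := fun h =>
  Set.projIcc (0 : ℝ) 1 zero_le_one ((algState ε h).price ε)

/-! ### The random walk -/

/-- The law of a sequence of independent fair coin flips. -/
def coinFlips : Measure (ℕ → Bool) :=
  Measure.infinitePi fun _ : ℕ => (PMF.uniformOfFintype Bool).toMeasure

/-- The unbiased random walk with step size `ε` started at `1/2`, driven by the coin flips `s`, and
stopped when its next step could leave `[0, 1]`. -/
def walk (ε : ℝ) (s : ℕ → Bool) : ℕ → ℝ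
  | 0 => 1 / 2
  | t + 1 =>
    if ε ≤ walk ε s t ∧ walk ε s t ≤ 1 - ε then walk ε s t + (if s t then ε else -ε)
    else walk ε s t

end DynamicPricing

end

namespace DynamicPricing

/-! ### The algorithm along a fixed sequence of values -/

/-! Upper bound. The confidence interval always contains the current value, and during the search
its length `L` becomes at most `L / 2 + 2 * ε`, so about `log (1/ε)` steps of a phase bring it to `6
* ε`. These steps are a fraction of order `ε ^ (2/3) * log (1/ε)` of the phase and lose at most `1`
each. Afterwards the price stays fixed. After a sale the loss is the drift of the value plus the
margin plus `O(ε log (1/ε))`. The drift is a martingale increment, so it is kept as a signed term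
and has mean zero. A rejection requires a fall of the order of the margin within one phase, which an
exponential moment bound makes rarer than `ε`. This is `loss_le_of_search_over` on a path,
`IsStochasticBuyer.integral_loss_le` in expectation, and `IsStochasticBuyer.integral_revenueLoss_le`
over the horizon.

Lower bound. While everything is sold the seller learns nothing, so the prices in an unbroken run of
sales are fixed in advance. In a window of about `ε ^ (-2/3)` steps the walk moves by about `ε ^
(2/3)` both up and down with constant probability. Either some price is rejected with constant
probability, and a rejection costs the whole value, or the later prices lie about `ε ^ (2/3)` below
the start, and every upward move loses that much. Both cases cost a constant per window
(`le_integral_window`). The Markov property applies this to every window whose start is away from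
`0` and `1`. Up to time `K * ε ^ (-2)` such starts have probability bounded below
(`walk_central_probability`), because `sin (π x)` is an eigenfunction of the walk's averaging
operator away from the boundary. Randomized sellers follow by Fubini. -/

lemma phaseLength_pos {ε : ℝ} (hε : 0 < ε) : 0 < phaseLength ε :=
  Nat.ceil_pos.2 (Real.rpow_pos_of_pos hε _)

lemma margin_nonneg {ε : ℝ} (hε : 0 < ε) : 0 ≤ margin ε := by
  unfold margin; positivity

/-- The state of the phase algorithm before step `t` against the values `x`. -/
noncomputable def stateAt (ε : ℝ) (x : ℕ → ℝ) (t : ℕ) : AlgState :=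
  algState ε (signals (phaseAlgorithm ε) x t)

lemma stateAt_succ (ε : ℝ) (x : ℕ → ℝ) (t : ℕ) :
    stateAt ε x (t + 1)
      = (stateAt ε x t).next ε (decide (priceAt (phaseAlgorithm ε) x t ≤ x t)) := rfl

lemma priceAt_eq (ε : ℝ) (x : ℕ → ℝ) (t : ℕ) :
    priceAt (phaseAlgorithm ε) x t = max 0 (min 1 ((stateAt ε x t).price ε)) := by
  simp [priceAt, phaseAlgorithm, stateAt, Set.coe_projIcc]

lemma stateAt_pos {ε : ℝ} (hε : 0 < ε) (x : ℕ → ℝ) (t : ℕ) :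
    (stateAt ε x t).pos = t % phaseLength ε := by
  induction t with
  | zero => simp [stateAt, signals, algState]
  | succ t ih =>
    have hm := phaseLength_pos hε
    have hlt := Nat.mod_lt t hm
    rw [stateAt_succ]
    simp only [AlgState.next, ih]
    split_ifs with h
    · rw [Nat.add_mod, Nat.mod_eq_of_lt (a := 1) (by omega), Nat.mod_eq_of_lt h]
    · rw [Nat.add_mod]
      rcases Nat.lt_or_ge 1 (phaseLength ε) with h1 | h1
      · rw [Nat.mod_eq_of_lt h1, show t % phaseLength ε + 1 = phaseLength ε by omega, Nat.mod_self]
      · rw [show phaseLength ε = 1 by omega]; simp [Nat.mod_one]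

/-- A sequence of values in `[0, 1]` that changes by at most `ε` per step. -/
structure IsPath (ε : ℝ) (x : ℕ → ℝ) : Prop where
  nonneg : ∀ t, 0 ≤ x t
  le_one : ∀ t, x t ≤ 1
  step_le : ∀ t, |x (t + 1) - x t| ≤ ε

lemma base_eq_none {ε : ℝ} {s : AlgState} :
    s.base ε = none ↔ s.anchor = none ∧ 6 * ε < s.hi - s.lo := by
  unfold AlgState.base
  cases s.anchor <;> simp [lt_sub_iff_add_lt]

lemma base_eq_some {ε l : ℝ} {s : AlgState} :
    s.base ε = some l ↔
      s.anchor = some l ∨ (s.anchor = none ∧ s.hi - s.lo ≤ 6 * ε ∧ s.lo = l) := by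
  unfold AlgState.base
  cases s.anchor <;> simp

lemma stateAt_bounds {ε : ℝ} {x : ℕ → ℝ} (hx : IsPath ε x) (t : ℕ) :
    0 ≤ (stateAt ε x t).lo ∧ (stateAt ε x t).lo ≤ x t ∧ x t ≤ (stateAt ε x t).hi ∧
      (stateAt ε x t).hi ≤ 1 := by
  induction t with
  | zero => simpa [stateAt, signals, algState] using ⟨hx.nonneg 0, hx.le_one 0⟩
  | succ t ih =>
    obtain ⟨h0, h1, h2, h3⟩ := ih
    obtain ⟨s1, s2⟩ := abs_le.1 (hx.step_le t)
    have n0 := hx.nonneg (t + 1)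
    have n1 := hx.le_one (t + 1)
    have hp := priceAt_eq ε x t
    rw [stateAt_succ]
    rcases hb : (stateAt ε x t).base ε with _ | l
    · have hprice : priceAt (phaseAlgorithm ε) x t
          = ((stateAt ε x t).lo + (stateAt ε x t).hi) / 2 := by
        rw [hp]
        simp only [AlgState.price, hb]
        rw [min_eq_right (by linarith), max_eq_right (by linarith)]
      simp only [AlgState.next, AlgState.nextInterval, hb, hprice, decide_eq_true_eq]
      split_ifs with h <;> refine ⟨le_max_left _ _, max_le n0 ?_, le_min n1 ?_, min_le_left _ _⟩ <;>
        linarith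
    · simp only [AlgState.next, AlgState.nextInterval, hb]
      refine ⟨le_max_left _ _, max_le n0 ?_, le_min n1 ?_, min_le_left _ _⟩ <;> linarith

/-- A search step sends the length `L` to at most `L / 2 + 2 * ε`, which has fixed point `4 * ε`, so
the excess over `4 * ε` halves. At a phase start the trivial bound `1` on the length suffices. -/
lemma stateAt_length {ε : ℝ} (hε : 0 < ε) {x : ℕ → ℝ} (hx : IsPath ε x) (t : ℕ)
    (h : (stateAt ε x t).anchor = none) :
    (stateAt ε x t).hi - (stateAt ε x t).lo - 4 * ε ≤ (1 / 2) ^ (t % phaseLength ε) := by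
  induction t with
  | zero =>
    simp [stateAt, signals, algState]; linarith
  | succ t ih =>
    obtain ⟨h0, -, -, h3⟩ := stateAt_bounds hx (t + 1)
    have hpos := stateAt_pos hε x (t + 1)
    have hpos' := stateAt_pos hε x t
    rw [← hpos]
    rw [← hpos'] at ih
    rw [stateAt_succ] at h h0 h3 ⊢
    set s := stateAt ε x t
    generalize decide (priceAt (phaseAlgorithm ε) x t ≤ x t) = b at h h0 h3 ⊢
    by_cases hm : s.pos + 1 < phaseLength ε
    · have hb : s.base ε = none := by simpa [AlgState.next, hm] using h
      have ih := ih (base_eq_none.1 hb).1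
      simp only [AlgState.next, AlgState.nextInterval, hm, if_true, hb]
      rw [pow_succ]
      have e1 := min_le_right 1 (s.hi + ε)
      have e2 := min_le_right 1 ((s.lo + s.hi) / 2 + ε)
      have e3 := le_max_right 0 ((s.lo + s.hi) / 2 - ε)
      have e4 := le_max_right 0 (s.lo - ε)
      split_ifs <;> simp only <;> linarith
    · have : (s.next ε b).pos = 0 := by simp [AlgState.next, hm]
      rw [this, pow_zero]; linarith

/-- When the search ends, the value is within `6 * ε` above `l`; each later step moves it by at most
`ε`. Counting from the phase start instead of from the end of the search is cruder but needs no
record of when the search ended. -/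
lemma stateAt_base_near {ε : ℝ} (hε : 0 < ε) {x : ℕ → ℝ} (hx : IsPath ε x) (t : ℕ) (l : ℝ)
    (h : (stateAt ε x t).base ε = some l) :
    l - (t % phaseLength ε : ℕ) * ε ≤ x t ∧ x t ≤ l + 6 * ε + (t % phaseLength ε : ℕ) * ε ∧
      l ≤ 1 := by
  induction t generalizing l with
  | zero =>
    simp only [stateAt, signals, algState, base_eq_some] at h
    have := hx.nonneg 0
    have := hx.le_one 0
    simp at h ⊢
    obtain ⟨h1, h2⟩ := h
    constructor
    · linarith
    · constructor <;> linarith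
  | succ t ih =>
    obtain ⟨b0, b1, b2, b3⟩ := stateAt_bounds hx (t + 1)
    obtain ⟨s1, s2⟩ := abs_le.1 (hx.step_le t)
    have hpos := stateAt_pos hε x (t + 1)
    have hpos' := stateAt_pos hε x t
    rcases base_eq_some.1 h with h | ⟨-, h, rfl⟩
    · rw [← hpos]
      rw [← hpos'] at ih
      rw [stateAt_succ] at h ⊢
      set s := stateAt ε x t
      by_cases hm : s.pos + 1 < phaseLength ε
      · have hb : s.base ε = some l := by simpa [AlgState.next, hm] using h
        obtain ⟨i1, i2, i3⟩ := ih l hb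
        simp only [AlgState.next, hm, if_true]
        push_cast
        refine ⟨?_, ?_, i3⟩ <;> linarith
      · simp [AlgState.next, hm] at h
    · have : 0 ≤ ((t + 1) % phaseLength ε : ℕ) * ε := by positivity
      refine ⟨?_, ?_, ?_⟩ <;> linarith

/-- Once the search of a phase is over, its lower end is kept until the end of the phase. -/
lemma stateAt_base_const {ε : ℝ} (hε : 0 < ε) {x : ℕ → ℝ} {a : ℕ} {l : ℝ}
    (h : (stateAt ε x a).base ε = some l) (n : ℕ)
    (hn : a % phaseLength ε + n < phaseLength ε) :
    (stateAt ε x (a + n)).base ε = some l := by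
  induction n with
  | zero => simpa using h
  | succ n ih =>
    have ih := ih (by omega)
    have hpos := stateAt_pos hε x (a + n)
    have hmod : (a + n) % phaseLength ε = a % phaseLength ε + n := by
      rw [Nat.add_mod, Nat.mod_eq_of_lt (a := n) (by omega), Nat.mod_eq_of_lt (by omega)]
    rw [hmod] at hpos
    rw [← add_assoc, stateAt_succ]
    refine base_eq_some.2 (Or.inl ?_)
    simp only [AlgState.next, hpos, ih, ite_eq_left_iff, reduceCtorEq, imp_false, not_not]
    omega

lemma stateAt_base_isSome {ε : ℝ} (hε : 0 < ε) {x : ℕ → ℝ} (hx : IsPath ε x) {N : ℕ}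
    (hN : (1 / 2 : ℝ) ^ N ≤ 2 * ε) (t : ℕ) (ht : t % phaseLength ε = N) :
    ∃ l, (stateAt ε x t).base ε = some l := by
  refine Option.ne_none_iff_exists'.1 fun h => ?_
  obtain ⟨h1, h2⟩ := base_eq_none.1 h
  have := stateAt_length hε hx t h1
  rw [ht] at this
  linarith

/-- The loss at a step after the search, `n` steps after the offset `N` of its phase. -/
lemma loss_le_of_search_over {ε : ℝ} (hε : 0 < ε) {x : ℕ → ℝ} (hx : IsPath ε x) {N : ℕ}
    (hN : (1 / 2 : ℝ) ^ N ≤ 2 * ε) {a n : ℕ} (ha : a % phaseLength ε = N)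
    (hn : N + n < phaseLength ε) {c : ℝ} (hc : 0 ≤ c) :
    x (a + n) - revenueAt (phaseAlgorithm ε) x (a + n)
      ≤ (x (a + n) - x a) + (6 * ε + N * ε + margin ε)
        + Real.exp (-c * (x (a + n) - x a)) * Real.exp (-c * (margin ε - N * ε)) := by
  obtain ⟨l, hl⟩ := stateAt_base_isSome hε hx hN a ha
  obtain ⟨h1, h2, h3⟩ := stateAt_base_near hε hx a l hl
  have hb := stateAt_base_const hε hl n (by omega)
  have hm := margin_nonneg hε
  rw [ha] at h1 h2
  have hp : priceAt (phaseAlgorithm ε) x (a + n) = max 0 (l - margin ε) := by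
    rw [priceAt_eq]
    simp only [AlgState.price, hb]
    rw [min_eq_right (by linarith)]
  have p1 := le_max_right 0 (l - margin ε)
  have hx0 := hx.nonneg (a + n)
  rw [← Real.exp_add]
  unfold revenueAt
  rw [hp]
  -- After a sale the exponential term is not needed. After a rejection the fall from `x a` exceeds
  -- `margin ε - N * ε`, so the product of exponentials is at least `1` and pays for the loss.
  split_ifs with hs
  · have := Real.exp_pos (-c * (x (a + n) - x a) + -c * (margin ε - N * ε))
    linarith
  · push Not at hs
    -- A price clipped to `0` is never rejected.
    have hlt : x (a + n) < l - margin ε := by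
      rcases lt_max_iff.1 hs with h | h
      · linarith
      · exact h
    have : 0 ≤ -c * (x (a + n) - x a) + -c * (margin ε - N * ε) := by
      have : 0 ≤ c * (x a - x (a + n) - (margin ε - N * ε)) := mul_nonneg hc (by linarith)
      linarith
    have := Real.one_le_exp this
    linarith

lemma revenueAt_nonneg (A : Seller) (x : ℕ → ℝ) (t : ℕ) : 0 ≤ revenueAt A x t := by
  unfold revenueAt
  split_ifs
  · exact (A _).2.1
  · exact le_rfl

lemma revenueAt_le (A : Seller) {x : ℕ → ℝ} {t : ℕ} (h : 0 ≤ x t) : revenueAt A x t ≤ x t := by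
  unfold revenueAt
  split_ifs with h1 <;> assumption

/-! ### Concentration of bounded martingales -/

/-- By convexity the exponential lies below its chord over `[-ε, ε]`. The chord is affine in `x`, so
its linear part vanishes against a martingale increment. -/
lemma exp_mul_le_cosh_add_sinh {ε x : ℝ} (hε : 0 < ε) (hx : |x| ≤ ε) (c : ℝ) :
    Real.exp (c * x) ≤ Real.cosh (c * ε) + x * (Real.sinh (c * ε) / ε) := by
  obtain ⟨h1, h2⟩ := abs_le.1 hx
  obtain ⟨-, hconv⟩ := convexOn_exp
  have h := hconv (Set.mem_univ (c * ε)) (Set.mem_univ (-(c * ε)))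
    (a := (ε + x) / (2 * ε)) (b := (ε - x) / (2 * ε))
    (div_nonneg (by linarith) (by linarith)) (div_nonneg (by linarith) (by linarith))
    (by field_simp; ring)
  simp only [smul_eq_mul] at h
  have e1 : (ε + x) / (2 * ε) * (c * ε) + (ε - x) / (2 * ε) * -(c * ε) = c * x := by
    field_simp; ring
  rw [e1] at h
  refine h.trans_eq ?_
  rw [Real.cosh_eq, Real.sinh_eq]
  field_simp
  ring

section Martingale

variable {Ω : Type*} {mΩ : MeasurableSpace Ω} {P : Measure Ω}
  {ℱ : Filtration ℕ mΩ} {v : ℕ → Ω → ℝ} {ε : ℝ}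

lemma integral_mul_martingale_sub_eq_zero [IsProbabilityMeasure P] (hv : Martingale v ℱ P) {W : Ω → ℝ} {t : ℕ}
    (hW : StronglyMeasurable[ℱ t] W) (hi : Integrable (W * (v (t + 1) - v t)) P) :
    ∫ ω, W ω * (v (t + 1) ω - v t ω) ∂P = 0 := by
  have h1 := condExp_mul_of_stronglyMeasurable_left (m := ℱ t) hW hi
    ((hv.integrable (t + 1)).sub (hv.integrable t))
  have h2 : P[v (t + 1) - v t | ℱ t] =ᵐ[P] 0 := by
    have e1 := condExp_sub (hv.integrable (t + 1)) (hv.integrable t) (ℱ t)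
    have e2 := hv.2 t (t + 1) (Nat.le_succ t)
    have e3 := hv.2 t t le_rfl
    filter_upwards [e1, e2, e3] with ω a b c
    rw [a, Pi.sub_apply, b, c]; simp
  calc ∫ ω, W ω * (v (t + 1) ω - v t ω) ∂P
      = ∫ ω, (P[W * (v (t + 1) - v t) | ℱ t]) ω ∂P := (integral_condExp (ℱ.le t)).symm
    _ = ∫ _, (0 : ℝ) ∂P := by
        refine integral_congr_ae ?_
        filter_upwards [h1, h2] with ω a b
        rw [a, Pi.mul_apply, b]; simp
    _ = 0 := by simp

lemma IsStochasticBuyer.mono {δ : ℝ} (hv : IsStochasticBuyer P ℱ ε v) (h : ε ≤ δ) :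
    IsStochasticBuyer P ℱ δ v :=
  ⟨hv.mem_Icc, hv.martingale, fun t => (hv.step_le t).mono fun _ hω => hω.trans h⟩

lemma IsStochasticBuyer.ae_isPath (hv : IsStochasticBuyer P ℱ ε v) :
    ∀ᵐ ω ∂P, IsPath ε fun t => v t ω := by
  filter_upwards [ae_all_iff.2 hv.mem_Icc, ae_all_iff.2 hv.step_le] with ω h1 h2
  exact ⟨fun t => (h1 t).1, fun t => (h1 t).2, h2⟩

lemma IsStochasticBuyer.measurable (hv : IsStochasticBuyer P ℱ ε v) (t : ℕ) :
    Measurable (v t) :=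
  ((hv.martingale.1 t).mono (ℱ.le t)).measurable

lemma IsStochasticBuyer.integrable_exp [IsProbabilityMeasure P] (hv : IsStochasticBuyer P ℱ ε v) (c : ℝ) (a t : ℕ) :
    Integrable (fun ω => Real.exp (c * (v t ω - v a ω))) P := by
  have := hv.measurable t
  have := hv.measurable a
  refine Integrable.of_bound (by fun_prop) (Real.exp |c|) ?_
  filter_upwards [hv.ae_isPath] with ω h
  rw [Real.norm_eq_abs, Real.abs_exp, Real.exp_le_exp]
  refine (le_abs_self _).trans ?_
  rw [abs_mul]
  refine mul_le_of_le_one_right (abs_nonneg _) (abs_le.2 ?_)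
  have := h.nonneg t
  have := h.nonneg a
  have := h.le_one t
  have := h.le_one a
  constructor <;> linarith

/-- The exponential moment bound behind the Azuma–Hoeffding inequality. -/
lemma IsStochasticBuyer.integral_exp_le [IsProbabilityMeasure P] (hv : IsStochasticBuyer P ℱ ε v) (hε : 0 < ε) (c : ℝ)
    (a n : ℕ) :
    ∫ ω, Real.exp (c * (v (a + n) ω - v a ω)) ∂P ≤ Real.exp (n * (c * ε) ^ 2 / 2) := by
  induction n with
  | zero => simp
  | succ n ih =>
    set W : Ω → ℝ := fun ω => Real.exp (c * (v (a + n) ω - v a ω)) with hWdef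
    have hWi : Integrable W P := hv.integrable_exp c a (a + n)
    have hWm : StronglyMeasurable[ℱ (a + n)] W := by
      have h1 := hv.martingale.1 (a + n)
      have h2 := (hv.martingale.1 a).mono (ℱ.mono (Nat.le_add_right a n))
      exact Real.continuous_exp.comp_stronglyMeasurable ((h1.sub h2).const_mul c)
    have hDi : Integrable (W * (v (a + n + 1) - v (a + n))) P := by
      have m1 := hv.measurable (a + n + 1)
      have m2 := hv.measurable (a + n)
      refine hWi.mul_bdd (c := ε) (m1.sub m2).aestronglyMeasurable ?_
      filter_upwards [hv.step_le (a + n)] with ω h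
      simpa using h
    have h0 := integral_mul_martingale_sub_eq_zero hv.martingale hWm hDi
    have hle : ∫ ω, Real.exp (c * (v (a + (n + 1)) ω - v a ω)) ∂P
        ≤ ∫ ω, (Real.cosh (c * ε) * W ω
          + (Real.sinh (c * ε) / ε) * (W ω * (v (a + n + 1) ω - v (a + n) ω))) ∂P := by
      refine integral_mono_ae (hv.integrable_exp c a _)
        ((hWi.const_mul _).add (hDi.const_mul _)) ?_
      filter_upwards [hv.step_le (a + n)] with ω h
      have h1 := exp_mul_le_cosh_add_sinh hε h c
      have h2 : Real.exp (c * (v (a + (n + 1)) ω - v a ω))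
          = W ω * Real.exp (c * (v (a + n + 1) ω - v (a + n) ω)) := by
        rw [hWdef, ← Real.exp_add, ← add_assoc]; congr 1; ring
      rw [h2]
      refine (mul_le_mul_of_nonneg_left h1 (Real.exp_pos _).le).trans_eq ?_
      simp only [hWdef]; ring
    have hsplit := integral_add (hWi.const_mul (Real.cosh (c * ε)))
      (hDi.const_mul (Real.sinh (c * ε) / ε))
    simp only [Pi.mul_apply, Pi.sub_apply] at hsplit
    rw [hsplit, integral_const_mul, integral_const_mul, h0, mul_zero, add_zero] at hle
    refine hle.trans ((mul_le_mul (Real.cosh_le_exp_half_sq _) ih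
      (integral_nonneg fun ω => (Real.exp_pos _).le) (Real.exp_pos _).le).trans_eq ?_)
    rw [← Real.exp_add]; congr 1; push_cast; ring

lemma IsStochasticBuyer.integral_eq [IsProbabilityMeasure P] (hv : IsStochasticBuyer P ℱ ε v) (a t : ℕ) :
    ∫ ω, v a ω ∂P = ∫ ω, v t ω ∂P := by
  have key : ∀ t, ∫ ω, v t ω ∂P = ∫ ω, v 0 ω ∂P := fun t => by
    rw [← integral_condExp (ℱ.le 0) (f := v t)]
    exact integral_congr_ae (hv.martingale.2 0 t (Nat.zero_le t))
  rw [key a, key t]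

end Martingale

/-! ### Measurability of the revenue loss -/

/-- Used with `g` the signal history: there are countably many histories, so a price chosen by
history is measurable without any structure on `Seller`. -/
lemma measurable_of_countable_cases {Θ ι β : Type*} [MeasurableSpace Θ] [MeasurableSpace β]
    [Countable ι] {g : Θ → ι} (hg : ∀ i, MeasurableSet {θ | g θ = i}) {F : ι → Θ → β}
    (hF : ∀ i, Measurable (F i)) : Measurable fun θ => F (g θ) θ := by
  intro s hs
  have : (fun θ => F (g θ) θ) ⁻¹' s = ⋃ i, {θ | g θ = i} ∩ F i ⁻¹' s := by
    ext θ; simp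
  rw [this]
  exact MeasurableSet.iUnion fun i => (hg i).inter (hF i hs)

section Measurability

variable {Θ : Type*} [MeasurableSpace Θ] {A : Θ → Seller} {x : ℕ → Θ → ℝ}

lemma measurableSet_signals_eq (hA : ∀ h, Measurable fun θ => A θ h)
    (hx : ∀ t, Measurable (x t)) (t : ℕ) (h : List Bool) :
    MeasurableSet {θ | signals (A θ) (fun t => x t θ) t = h} := by
  induction t generalizing h with
  | zero => simp [signals]
  | succ t ih =>
    have hp : Measurable fun θ => (A θ (signals (A θ) (fun t => x t θ) t) : ℝ) :=
      measurable_of_countable_cases ih fun h => (hA h).subtype_val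
    have hs := measurableSet_le hp (hx t)
    rcases h with _ | ⟨b, h⟩
    · simp [signals]
    · cases b
      · convert hs.compl.inter (ih h) using 1
        ext θ; simp [signals]
      · convert hs.inter (ih h) using 1
        ext θ; simp [signals]

lemma measurable_revenueAt (hA : ∀ h, Measurable fun θ => A θ h)
    (hx : ∀ t, Measurable (x t)) (t : ℕ) :
    Measurable fun θ => revenueAt (A θ) (fun t => x t θ) t := by
  have hp : Measurable fun θ => priceAt (A θ) (fun t => x t θ) t :=
    measurable_of_countable_cases (measurableSet_signals_eq hA hx t)
      fun h => (hA h).subtype_val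
  exact Measurable.ite (measurableSet_le hp (hx t)) hp measurable_const

lemma integrable_loss (hA : ∀ h, Measurable fun θ => A θ h) (hx : ∀ t, Measurable (x t))
    {μ : Measure Θ} [IsFiniteMeasure μ] (t : ℕ) (hb : ∀ᵐ θ ∂μ, x t θ ∈ Set.Icc (0 : ℝ) 1) :
    Integrable (fun θ => x t θ - revenueAt (A θ) (fun t => x t θ) t) μ := by
  refine Integrable.of_bound ((hx t).sub (measurable_revenueAt hA hx t)).aestronglyMeasurable 1 ?_
  filter_upwards [hb] with θ h
  have h1 := revenueAt_le (A θ) (x := fun t => x t θ) (t := t) h.1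
  have h2 := revenueAt_nonneg (A θ) (fun t => x t θ) t
  have := h.2
  rw [Real.norm_eq_abs, abs_le]
  constructor <;> linarith

lemma integrable_revenueLoss (hA : ∀ h, Measurable fun θ => A θ h) (hx : ∀ t, Measurable (x t))
    {μ : Measure Θ} [IsFiniteMeasure μ] (hb : ∀ t, ∀ᵐ θ ∂μ, x t θ ∈ Set.Icc (0 : ℝ) 1)
    (T : ℕ) : Integrable (fun θ => revenueLoss (A θ) (fun t => x t θ) T) μ :=
  (integrable_finsetSum _ fun t _ => integrable_loss hA hx t (hb t)).const_mul _

end Measurability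

/-! ### The revenue loss of the algorithm -/

section Upper

variable {Ω : Type*} {mΩ : MeasurableSpace Ω} {P : Measure Ω} [IsProbabilityMeasure P]
  {ℱ : Filtration ℕ mΩ} {v : ℕ → Ω → ℝ} {ε : ℝ}

lemma IsStochasticBuyer.integrable_loss (hv : IsStochasticBuyer P ℱ ε v) (A : Seller) (t : ℕ) :
    Integrable (fun ω => v t ω - revenueAt A (fun t => v t ω) t) P :=
  DynamicPricing.integrable_loss (A := fun _ => A) (fun _ => measurable_const) hv.measurable t
    (hv.mem_Icc t)

lemma IsStochasticBuyer.integrable_revenueLoss (hv : IsStochasticBuyer P ℱ ε v) (A : Seller)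
    (T : ℕ) : Integrable (fun ω => revenueLoss A (fun t => v t ω) T) P :=
  DynamicPricing.integrable_revenueLoss (A := fun _ => A) (fun _ => measurable_const)
    hv.measurable hv.mem_Icc T

lemma IsStochasticBuyer.integral_loss_le_one (hv : IsStochasticBuyer P ℱ ε v) (A : Seller)
    (t : ℕ) : ∫ ω, (v t ω - revenueAt A (fun t => v t ω) t) ∂P ≤ 1 := by
  refine (integral_mono_ae (hv.integrable_loss A t) (integrable_const 1) ?_).trans_eq (by simp)
  filter_upwards [hv.mem_Icc t] with ω h
  have := revenueAt_nonneg A (fun t => v t ω) t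
  have := h.2
  linarith

lemma IsStochasticBuyer.integral_revenueLoss (hv : IsStochasticBuyer P ℱ ε v) (A : Seller)
    (T : ℕ) : ∫ ω, revenueLoss A (fun t => v t ω) T ∂P
      = (1 / (T : ℝ)) * ∑ t ∈ Finset.range T,
          ∫ ω, (v t ω - revenueAt A (fun t => v t ω) t) ∂P := by
  unfold revenueLoss
  rw [integral_const_mul, integral_finsetSum _ fun t _ => hv.integrable_loss A t]

lemma IsStochasticBuyer.integral_revenueLoss_le_one (hv : IsStochasticBuyer P ℱ ε v) (A : Seller)
    {T : ℕ} (hT : 1 ≤ T) : ∫ ω, revenueLoss A (fun t => v t ω) T ∂P ≤ 1 := by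
  rw [hv.integral_revenueLoss]
  have hT' : (0 : ℝ) < T := by exact_mod_cast hT
  rw [one_div, inv_mul_le_iff₀ hT']
  exact (Finset.sum_le_sum fun t _ => hv.integral_loss_le_one A t).trans_eq (by simp)

/-- The comparison time `a` is the step at offset `N` of the phase containing `t`, when the search
is certainly over. -/
lemma IsStochasticBuyer.integral_loss_le (hv : IsStochasticBuyer P ℱ ε v) (hε : 0 < ε) {N : ℕ}
    (hN : (1 / 2 : ℝ) ^ N ≤ 2 * ε) {t : ℕ} (ht : N ≤ t % phaseLength ε)
    (hM : 0 ≤ margin ε - N * ε) :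
    ∫ ω, (v t ω - revenueAt (phaseAlgorithm ε) (fun t => v t ω) t) ∂P
      ≤ 6 * ε + N * ε + margin ε
        + Real.exp (-((margin ε - N * ε) ^ 2 / (2 * (phaseLength ε * ε ^ 2)))) := by
  have hmpos := phaseLength_pos hε
  have hlt := Nat.mod_lt t hmpos
  have hm0 : (0 : ℝ) < phaseLength ε := by exact_mod_cast hmpos
  obtain ⟨n, hn⟩ := Nat.exists_eq_add_of_le ht
  obtain ⟨a, rfl⟩ : ∃ a, t = a + n := ⟨t - n, by have := Nat.mod_le t (phaseLength ε); omega⟩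
  have hdiv := Nat.div_add_mod (a + n) (phaseLength ε)
  rw [hn] at hdiv
  have ha : a % phaseLength ε = N := by
    have : a = N + phaseLength ε * ((a + n) / phaseLength ε) := by omega
    rw [this, Nat.add_mul_mod_self_left, Nat.mod_eq_of_lt (by omega)]
  set M := margin ε - N * ε with hMdef
  -- This minimizes the Chernoff exponent `m * (c * ε) ^ 2 / 2 - c * M`, where `m` is the phase
  -- length.
  set c := M / (phaseLength ε * ε ^ 2) with hcdef
  have hc : 0 ≤ c := by positivity
  have i1 : Integrable (fun ω => v (a + n) ω - v a ω) P :=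
    (hv.martingale.integrable _).sub (hv.martingale.integrable _)
  have i2 := hv.integrable_exp (-c) a (a + n)
  refine (integral_mono_ae (hv.integrable_loss _ _)
    ((i1.add (integrable_const (6 * ε + N * ε + margin ε))).add
      (i2.mul_const (Real.exp (-c * M)))) ?_).trans ?_
  · filter_upwards [hv.ae_isPath] with ω h
    exact loss_le_of_search_over hε h hN ha (by omega) hc
  · have hs : ∫ ω, (v (a + n) ω - v a ω) ∂P = 0 := by
      rw [integral_sub (hv.martingale.integrable _) (hv.martingale.integrable _),
        hv.integral_eq (a + n) a, sub_self]
    rw [integral_add' (i1.add (integrable_const _)) (i2.mul_const _),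
      integral_add' i1 (integrable_const _), integral_mul_const, hs]
    simp only [integral_const, probReal_univ, one_smul, zero_add]
    gcongr
    refine (mul_le_mul_of_nonneg_right (hv.integral_exp_le hε (-c) a n)
      (Real.exp_pos _).le).trans ?_
    rw [← Real.exp_add, Real.exp_le_exp]
    have hnm : (n : ℝ) ≤ phaseLength ε := by exact_mod_cast (by omega : n ≤ phaseLength ε)
    have e1 : (n : ℝ) * (-c * ε) ^ 2 / 2 ≤ phaseLength ε * (-c * ε) ^ 2 / 2 := by gcongr
    refine (add_le_add_left e1 _).trans_eq ?_
    rw [hcdef]; field_simp; ring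

/-- The `+ 1` accounts for a last, incomplete phase; it becomes the `1 / T` term of the theorem. -/
lemma card_filter_mod_lt_le (m N T : ℕ) :
    ((Finset.range T).filter fun t => t % m < N).card ≤ N * (T / m + 1) := by
  calc ((Finset.range T).filter fun t => t % m < N).card
      ≤ (Finset.range N ×ˢ Finset.range (T / m + 1)).card := by
        refine Finset.card_le_card_of_injOn (fun t => (t % m, t / m)) ?_ ?_
        · intro t ht
          simp only [Finset.coe_filter, Finset.mem_range, Set.mem_ofPred_eq] at ht
          simp only [Finset.coe_product, Finset.coe_range, Set.mem_prod, Set.mem_Iio]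
          exact ⟨ht.2, Nat.lt_succ_of_le (Nat.div_le_div_right ht.1.le)⟩
        · intro s _ t _ h
          simp only [Prod.mk.injEq] at h
          rw [← Nat.div_add_mod s m, ← Nat.div_add_mod t m, h.1, h.2]
    _ = _ := by simp

lemma IsStochasticBuyer.integral_revenueLoss_le (hv : IsStochasticBuyer P ℱ ε v) (hε : 0 < ε)
    {N : ℕ} (hN : (1 / 2 : ℝ) ^ N ≤ 2 * ε) (hM : 0 ≤ margin ε - N * ε) {D : ℝ}
    (hD : 6 * ε + N * ε + margin ε
        + Real.exp (-((margin ε - N * ε) ^ 2 / (2 * (phaseLength ε * ε ^ 2)))) ≤ D)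
    {T : ℕ} (hT : 1 ≤ T) :
    ∫ ω, revenueLoss (phaseAlgorithm ε) (fun t => v t ω) T ∂P
      ≤ N * (1 / phaseLength ε + 1 / T) + D := by
  have hT' : (0 : ℝ) < T := by exact_mod_cast hT
  have hmpos := phaseLength_pos hε
  have hm0 : (0 : ℝ) < phaseLength ε := by exact_mod_cast hmpos
  have hD0 : 0 ≤ D := by
    refine le_trans ?_ hD
    have := margin_nonneg hε
    positivity
  rw [hv.integral_revenueLoss, one_div (T : ℝ), inv_mul_le_iff₀ hT']
  have step : ∀ t, ∫ ω, (v t ω - revenueAt (phaseAlgorithm ε) (fun t => v t ω) t) ∂P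
      ≤ (if t % phaseLength ε < N then 1 else 0) + D := by
    intro t
    split_ifs with h
    · linarith [hv.integral_loss_le_one (phaseAlgorithm ε) t]
    · linarith [hv.integral_loss_le hε hN (not_lt.1 h) hM]
  refine (Finset.sum_le_sum fun t _ => step t).trans ?_
  rw [Finset.sum_add_distrib, Finset.sum_boole, Finset.sum_const, Finset.card_range, nsmul_eq_mul]
  have h1 : (((Finset.range T).filter fun t => t % phaseLength ε < N).card : ℝ)
      ≤ N * (T / phaseLength ε + 1) := by
    refine (Nat.cast_le.2 (card_filter_mod_lt_le _ N T)).trans ?_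
    push_cast
    gcongr
    exact Nat.cast_div_le
  refine (add_le_add_left h1 _).trans_eq ?_
  field_simp

end Upper

/-! ### Choice of the search length and the resulting rate -/

section Upper

variable {Ω : Type*} {mΩ : MeasurableSpace Ω} {P : Measure Ω} [IsProbabilityMeasure P]
  {ℱ : Filtration ℕ mΩ} {v : ℕ → Ω → ℝ} {ε : ℝ}

/-- The upper bound for small changing rates. -/
lemma IsStochasticBuyer.integral_revenueLoss_le_of_small (hv : IsStochasticBuyer P ℱ ε v)
    (hε : 0 < ε) (hL : 8 ≤ Real.log (1 / ε)) {T : ℕ} (hT : 1 ≤ T) :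
    ∫ ω, revenueLoss (phaseAlgorithm ε) (fun t => v t ω) T ∂P
      ≤ 15 * (1 + Real.log (1 / ε)) * (ε ^ (2 / 3 : ℝ) + 1 / T) := by
  set L := Real.log (1 / ε) with hLdef
  set d := ε ^ (2 / 3 : ℝ) with hd
  have hεL : ε = Real.exp (-L) := by
    rw [hLdef, Real.exp_neg, Real.exp_log (by positivity)]; simp
  have hdL : d = Real.exp (-(2 * L / 3)) := by
    rw [hd, hεL, ← Real.exp_mul]; congr 1; ring
  have hd0 : 0 < d := by positivity
  have hεd : ε ≤ d := by
    rw [hεL, hdL, Real.exp_le_exp]; linarith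
  have hd3 : d ^ 3 = ε ^ 2 := by
    rw [hεL, hdL, ← Real.exp_nat_mul, ← Real.exp_nat_mul]; congr 1; push_cast; ring
  have hd1 : d ≤ 1 := by
    rw [hdL]; exact Real.exp_le_one_iff.2 (by linarith)
  have hm1 : 1 / (phaseLength ε : ℝ) ≤ d := by
    have : d⁻¹ ≤ phaseLength ε := by
      rw [hd, ← Real.rpow_neg hε.le]; exact Nat.le_ceil _
    rw [one_div]
    exact inv_le_of_inv_le₀ hd0 this
  have hm2 : (phaseLength ε : ℝ) ≤ 2 / d := by
    have h1 : (phaseLength ε : ℝ) < d⁻¹ + 1 := by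
      rw [hd, ← Real.rpow_neg hε.le]
      exact Nat.ceil_lt_add_one (by positivity)
    have h2 : 1 ≤ d⁻¹ := (one_le_inv₀ hd0).2 hd1
    rw [div_eq_mul_inv]; linarith
  have hmarg : margin ε = 4 * d * √L := rfl
  have hs2 : √L ^ 2 = L := Real.sq_sqrt (by linarith)
  have hs0 : 0 ≤ √L := Real.sqrt_nonneg L
  set s := √L
  -- Since `1 / 2 ≤ exp (-1/2)`, `2 * L` halvings already reach `exp (-L) = ε`.
  set N := ⌈2 * L⌉₊ with hNdef
  have hN1 : (N : ℝ) ≤ 2 * L + 1 := (Nat.ceil_lt_add_one (by linarith)).le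
  have hN2 : 2 * L ≤ (N : ℝ) := Nat.le_ceil _
  have hN : (1 / 2 : ℝ) ^ N ≤ 2 * ε := by
    have h1 : (1 / 2 : ℝ) ≤ Real.exp (-(1 / 2)) := by
      have := Real.add_one_le_exp (-(1 / 2) : ℝ)
      linarith
    have h2 : (1 / 2 : ℝ) ^ N ≤ Real.exp (-(1 / 2)) ^ N := by gcongr
    have h3 : Real.exp (-(1 / 2)) ^ N ≤ ε := by
      rw [hεL, ← Real.exp_nat_mul, Real.exp_le_exp]; linarith
    linarith
  -- `√L * ε ^ (1/3) ≤ 2/3`, in squared form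
  have hLd : L * d ≤ 4 / 9 := by
    have h1 := Real.quadratic_le_exp_of_nonneg (x := 2 * L / 3) (by linarith)
    rw [hdL, Real.exp_neg, ← div_eq_mul_inv, div_le_iff₀ (Real.exp_pos _)]
    nlinarith
  -- The drift during the search uses up at most half of the margin `4 * d * s`.
  have hNε : (N : ℝ) * ε ≤ 2 * d * s := by
    have h1 : (N : ℝ) * ε ≤ 3 * L * ε := by gcongr; linarith
    refine h1.trans (abs_le_of_sq_le_sq' ?_ (by positivity)).2
    have : (3 * L * ε) ^ 2 = 9 * L ^ 2 * d ^ 3 := by rw [hd3]; ring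
    rw [this, mul_pow, hs2]
    have : 9 * L ^ 2 * d ^ 3 = 9 * (L * d) * (L * d ^ 2) := by ring
    rw [this]
    have : 0 ≤ L * d ^ 2 := by positivity
    nlinarith
  have hM2 : 2 * d * s ≤ margin ε - N * ε := by rw [hmarg]; linarith
  have hM0 : 0 ≤ 2 * d * s := by positivity
  have hsL : s ≤ 1 + L := by nlinarith
  have hm0 : (0 : ℝ) < phaseLength ε := by exact_mod_cast phaseLength_pos hε
  -- With `M ≥ 2 * d * s` and `phaseLength ε * ε ^ 2 ≤ 2 * d ^ 2`, the exponent is at least `s ^ 2 =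
  -- L`.
  have hexp : Real.exp (-((margin ε - N * ε) ^ 2 / (2 * (phaseLength ε * ε ^ 2)))) ≤ ε := by
    rw [hεL, Real.exp_le_exp, neg_le_neg_iff, ← hεL, le_div_iff₀ (by positivity)]
    have h1 : phaseLength ε * ε ^ 2 ≤ 2 * d ^ 2 := by
      calc phaseLength ε * ε ^ 2 ≤ 2 / d * ε ^ 2 := by gcongr
        _ = 2 * d ^ 2 := by rw [← hd3]; field_simp
    calc L * (2 * (phaseLength ε * ε ^ 2)) ≤ L * (2 * (2 * d ^ 2)) := by gcongr
      _ = (2 * d * s) ^ 2 := by rw [mul_pow, hs2]; ring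
      _ ≤ _ := by gcongr
  have hD : 6 * ε + N * ε + margin ε
        + Real.exp (-((margin ε - N * ε) ^ 2 / (2 * (phaseLength ε * ε ^ 2))))
      ≤ 13 * (1 + L) * d := by
    have h1 : d * s ≤ d * (1 + L) := by gcongr
    have h2 : d ≤ d * (1 + L) := by nlinarith
    rw [hmarg] at *
    linarith
  refine (hv.integral_revenueLoss_le hε hN (hM0.trans hM2) hD hT).trans ?_
  have hT' : (0 : ℝ) ≤ 1 / T := by positivity
  calc N * (1 / phaseLength ε + 1 / T) + 13 * (1 + L) * d
      ≤ (2 * (1 + L)) * (d + 1 / T) + 13 * (1 + L) * (d + 1 / T) := by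
        gcongr <;> linarith
    _ = _ := by ring

lemma IsStochasticBuyer.integral_phaseAlgorithm_le (hv : IsStochasticBuyer P ℱ ε v)
    (hε : 0 < ε) (hε1 : ε ≤ 1) {T : ℕ} (hT : 1 ≤ T) :
    ∫ ω, revenueLoss (phaseAlgorithm ε) (fun t => v t ω) T ∂P
      ≤ (15 + Real.exp 6) * (1 + Real.log (1 / ε)) * (ε ^ (2 / 3 : ℝ) + 1 / T) := by
  have hL0 : 0 ≤ Real.log (1 / ε) := Real.log_nonneg (by rw [le_div_iff₀ hε]; linarith)
  have hT' : (0 : ℝ) ≤ 1 / T := by positivity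
  rcases le_total 8 (Real.log (1 / ε)) with h | h
  · refine (hv.integral_revenueLoss_le_of_small hε h hT).trans ?_
    gcongr
    linarith [Real.exp_pos 6]
  · refine (hv.integral_revenueLoss_le_one _ hT).trans ?_
    -- For `log (1/ε) ≤ 8` the target rate is at least `exp (-16/3)`, so the trivial loss bound `1`
    -- is enough.
    have h1 : Real.exp (-6) ≤ ε ^ (2 / 3 : ℝ) := by
      rw [Real.rpow_def_of_pos hε, Real.exp_le_exp]
      rw [one_div, Real.log_inv] at h
      linarith
    have h2 : Real.exp 6 * Real.exp (-6) = 1 := by rw [← Real.exp_add]; simp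
    calc (1 : ℝ) = Real.exp 6 * 1 * Real.exp (-6) := by linarith
      _ ≤ (15 + Real.exp 6) * (1 + Real.log (1 / ε)) * (ε ^ (2 / 3 : ℝ) + 1 / T) := by
        gcongr
        · linarith
        · linarith
        · linarith

/-- The upper bound for a horizon that is short compared to the inverse changing rate. -/
lemma IsStochasticBuyer.integral_phaseAlgorithm_max_le (hv : IsStochasticBuyer P ℱ ε v)
    (hε : 0 < ε) (hε1 : ε ≤ 1) {T : ℕ} (hT : 1 ≤ T) :
    ∫ ω, revenueLoss (phaseAlgorithm (max ε (1 / T))) (fun t => v t ω) T ∂P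
      ≤ 2 * (15 + Real.exp 6) * (1 + Real.log (1 / ε)) * ε ^ (2 / 3 : ℝ)
        + (15 + Real.exp 6) * (1 + Real.log T) * ((T : ℝ) ^ (-(2 / 3) : ℝ) + 1 / T) := by
  have hT' : (1 : ℝ) ≤ T := by exact_mod_cast hT
  have hL0 : 0 ≤ Real.log (1 / ε) := Real.log_nonneg (by rw [le_div_iff₀ hε]; linarith)
  have hlT : 0 ≤ Real.log T := Real.log_nonneg hT'
  have hC := Real.exp_pos 6
  rcases le_total (1 / (T : ℝ)) ε with h | h
  · rw [max_eq_left h]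
    have h2 : ε ≤ ε ^ (2 / 3 : ℝ) := by
      simpa using Real.rpow_le_rpow_of_exponent_ge hε hε1 (show (2 / 3 : ℝ) ≤ 1 by norm_num)
    have h3 : 0 ≤ (15 + Real.exp 6) * (1 + Real.log T) * ((T : ℝ) ^ (-(2 / 3) : ℝ) + 1 / T) := by
      positivity
    refine (hv.integral_phaseAlgorithm_le hε hε1 hT).trans ?_
    calc (15 + Real.exp 6) * (1 + Real.log (1 / ε)) * (ε ^ (2 / 3 : ℝ) + 1 / T)
        ≤ (15 + Real.exp 6) * (1 + Real.log (1 / ε)) * (ε ^ (2 / 3 : ℝ) + ε ^ (2 / 3 : ℝ)) := by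
          gcongr; linarith
      _ ≤ _ := by linarith
  · rw [max_eq_right h]
    -- The buyer also has the larger changing rate `1 / T`, so the loss is bounded in terms of `T`
    -- alone.
    have h1 := (hv.mono h).integral_phaseAlgorithm_le (by positivity)
      (by rw [div_le_one (by linarith)]; exact hT') hT
    rw [one_div_one_div, one_div, Real.inv_rpow (by linarith),
      ← Real.rpow_neg (by linarith), ← one_div] at h1
    refine h1.trans (le_add_of_nonneg_left (by positivity))

end Upper

lemma tendsto_log_mul_rpow_add_inv (C : ℝ) :
    Tendsto (fun T : ℕ => C * (1 + Real.log T) * ((T : ℝ) ^ (-(2 / 3) : ℝ) + 1 / T))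
      atTop (𝓝 0) := by
  have key : ∀ r : ℝ, 0 < r →
      Tendsto (fun x : ℝ => (1 + Real.log x) * x ^ (-r)) atTop (𝓝 0) := by
    intro r hr
    have h1 := tendsto_rpow_neg_atTop hr
    have h2 := (isLittleO_log_rpow_atTop hr).tendsto_div_nhds_zero
    have h3 := h1.add h2
    rw [add_zero] at h3
    refine h3.congr' ?_
    filter_upwards [eventually_gt_atTop 0] with x hx
    rw [Real.rpow_neg hx.le]; ring
  have h := (((key (2 / 3) (by norm_num)).add (key 1 one_pos)).const_mul C).comp
    tendsto_natCast_atTop_atTop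
  rw [add_zero, mul_zero] at h
  refine h.congr fun T => ?_
  simp only [Function.comp_apply, Real.rpow_neg_one]
  ring

/-! ### Coin flips -/

instance : IsProbabilityMeasure coinFlips := by
  unfold coinFlips; infer_instance

/-- Reverse the `t`-th coin flip. -/
def flipAt (t : ℕ) (s : ℕ → Bool) (i : ℕ) : Bool := (if i = t then not else id) (s i)

lemma measurePreserving_flipAt (t : ℕ) : MeasurePreserving (flipAt t) coinFlips coinFlips := by
  have hm : ∀ i : ℕ, Measurable (if i = t then not else id : Bool → Bool) :=
    fun _ => measurable_of_finite _
  refine ⟨measurable_pi_iff.2 fun i => (hm i).comp (measurable_pi_apply i), ?_⟩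
  have h := Measure.infinitePi_map_pi (fun _ : ℕ => (PMF.uniformOfFintype Bool).toMeasure) hm
  refine h.trans ?_
  unfold coinFlips
  congr 1
  funext i
  split_ifs
  · refine Measure.ext_of_singleton fun b => ?_
    rw [Measure.map_apply (measurable_of_finite _) (measurableSet_singleton b)]
    have : not ⁻¹' {b} = {!b} := by ext c; cases b <;> cases c <;> simp
    rw [this, PMF.toMeasure_apply_singleton _ _ (measurableSet_singleton _),
      PMF.toMeasure_apply_singleton _ _ (measurableSet_singleton _)]
    simp
  · exact Measure.map_id

section DependsOn

variable {β : Type*} {f : (ℕ → Bool) → β} {S : Finset ℕ}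

lemma _root_.DependsOn.exists_comp_restrict (hf : DependsOn f S) :
    ∃ g : (S → Bool) → β, f = fun s => g fun i => s i := by
  have : Nonempty β := ⟨f fun _ => true⟩
  obtain ⟨g, rfl⟩ := dependsOn_iff_exists_comp.1 hf
  exact ⟨g, rfl⟩

lemma _root_.DependsOn.measurable_of_finset [MeasurableSpace β] (hf : DependsOn f S) :
    Measurable f := by
  obtain ⟨g, rfl⟩ := hf.exists_comp_restrict
  exact (measurable_of_finite g).comp (measurable_pi_iff.2 fun i => measurable_pi_apply _)

lemma _root_.DependsOn.integrable_of_finset {f : (ℕ → Bool) → ℝ} (hf : DependsOn f S) :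
    Integrable f coinFlips := by
  have hm := hf.measurable_of_finset
  obtain ⟨g, rfl⟩ := hf.exists_comp_restrict
  refine Integrable.of_bound hm.aestronglyMeasurable (∑ u, ‖g u‖) (ae_of_all _ fun s => ?_)
  exact Finset.single_le_sum (f := fun u => ‖g u‖) (fun u _ => norm_nonneg _) (Finset.mem_univ _)

end DependsOn

/-- Averaging over the flip number `t` of a function that otherwise depends on earlier flips. -/
lemma integral_coin {t : ℕ} {f : (ℕ → Bool) → Bool → ℝ}
    (hf : ∀ b, DependsOn (fun s => f s b) (Finset.range t : Finset ℕ)) :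
    ∫ s, f s (s t) ∂coinFlips = ∫ s, (f s true + f s false) / 2 ∂coinFlips := by
  have hd : DependsOn (fun s => f s (s t)) (Finset.range (t + 1) : Finset ℕ) := by
    intro x y h
    have : x t = y t := h t (by simp)
    simp only [this]
    exact hf (y t) fun i hi => h i (by simp at hi ⊢; omega)
  have hflip : ∀ s, f (flipAt t s) (flipAt t s t) = f s (!s t) := by
    intro s
    have : flipAt t s t = !s t := by simp [flipAt]
    rw [this]
    refine hf (!s t) fun i hi => ?_
    simp only [Finset.coe_range, Set.mem_Iio] at hi
    simp [flipAt, hi.ne]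
  have hmp := measurePreserving_flipAt t
  have h1 : ∫ s, f s (!s t) ∂coinFlips = ∫ s, f s (s t) ∂coinFlips := by
    conv_rhs => rw [← hmp.map_eq]
    rw [integral_map hmp.measurable.aemeasurable hd.measurable_of_finset.aestronglyMeasurable]
    simp only [hflip]
  have hd' : DependsOn (fun s => f s (!s t)) (Finset.range (t + 1) : Finset ℕ) := by
    intro x y h
    have : x t = y t := h t (by simp)
    simp only [this]
    exact hf (!y t) fun i hi => h i (by simp at hi ⊢; omega)
  -- Reversing flip `t` preserves the law and swaps the two summands.
  have h2 : ∫ s, (f s true + f s false) / 2 ∂coinFlips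
      = ∫ s, (f s (s t) + f s (!s t)) / 2 ∂coinFlips := by
    congr 1
    funext s
    cases s t
    · simp [add_comm]
    · simp
  rw [h2, integral_div, integral_add hd.integrable_of_finset hd'.integrable_of_finset, h1]
  ring

/-! ### The random walk -/

/-- One step of the stopped random walk. -/
noncomputable def walkStep (ε x : ℝ) (b : Bool) : ℝ :=
  if ε ≤ x ∧ x ≤ 1 - ε then x + (if b then ε else -ε) else x

lemma walk_succ (ε : ℝ) (s : ℕ → Bool) (t : ℕ) :
    walk ε s (t + 1) = walkStep ε (walk ε s t) (s t) := rfl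

lemma walkStep_mem_Icc {ε x : ℝ} (hx : x ∈ Set.Icc (0 : ℝ) 1) (b : Bool) (hε : 0 < ε) :
    walkStep ε x b ∈ Set.Icc (0 : ℝ) 1 := by
  unfold walkStep
  split_ifs with h
  · constructor <;> linarith
  · constructor <;> linarith
  · exact hx

lemma abs_walkStep_sub_le {ε : ℝ} (hε : 0 < ε) (x : ℝ) (b : Bool) : |walkStep ε x b - x| ≤ ε := by
  unfold walkStep
  cases b <;> split_ifs <;> simp_all [abs_of_pos hε, hε.le]

lemma walkStep_average (ε x : ℝ) : (walkStep ε x true + walkStep ε x false) / 2 = x := by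
  unfold walkStep
  by_cases h : ε ≤ x ∧ x ≤ 1 - ε
  · simp only [h, and_self, if_true, Bool.false_eq_true, if_false]
    ring
  · simp [h]

lemma walk_mem_Icc {ε : ℝ} (hε : 0 < ε) (s : ℕ → Bool) (t : ℕ) :
    walk ε s t ∈ Set.Icc (0 : ℝ) 1 := by
  induction t with
  | zero => norm_num [walk]
  | succ t ih => exact walkStep_mem_Icc ih _ hε

lemma dependsOn_walk (ε : ℝ) (t : ℕ) :
    DependsOn (fun s => walk ε s t) (Finset.range t : Finset ℕ) := by
  induction t with
  | zero => intro x y _; rfl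
  | succ t ih =>
    intro x y h
    simp only [walk_succ]
    have h1 : walk ε x t = walk ε y t := ih fun i hi => h i (by simp at hi ⊢; omega)
    rw [h1, h t (by simp)]

lemma measurable_walk (ε : ℝ) (t : ℕ) : Measurable fun s => walk ε s t :=
  (dependsOn_walk ε t).measurable_of_finset

/-- The information contained in the first `t` coin flips. -/
def coinFiltration : Filtration ℕ (MeasurableSpace.pi : MeasurableSpace (ℕ → Bool)) where
  seq t := Filtration.piFinset (X := fun _ : ℕ => Bool) (Finset.range t)
  mono' _ _ h := Filtration.piFinset.mono (Finset.range_mono h)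
  le' t := Filtration.piFinset.le (Finset.range t)

lemma _root_.DependsOn.stronglyMeasurable_coinFiltration {f : (ℕ → Bool) → ℝ} {t : ℕ}
    (hf : DependsOn f (Finset.range t : Finset ℕ)) : StronglyMeasurable[coinFiltration t] f := by
  obtain ⟨g, rfl⟩ := hf.exists_comp_restrict
  exact ((measurable_of_finite g).comp (comap_measurable _)).stronglyMeasurable

lemma martingale_walk (ε : ℝ) : Martingale (fun t s => walk ε s t) coinFiltration coinFlips := by
  refine martingale_of_setIntegral_eq_succ
    (fun t => (dependsOn_walk ε t).stronglyMeasurable_coinFiltration)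
    (fun t => (dependsOn_walk ε t).integrable_of_finset) fun t B hB => ?_
  have hB' : MeasurableSet B := coinFiltration.le t B hB
  -- An event of time `t` is decided by the first `t` flips, so its indicator can be carried through
  -- `integral_coin`.
  have hdep : ∀ x y : ℕ → Bool, (∀ i < t, x i = y i) → (x ∈ B ↔ y ∈ B) := by
    intro x y h
    obtain ⟨B', -, rfl⟩ := hB
    have : (Finset.range t).restrict x = (Finset.range t).restrict y := by
      funext i; exact h i (Finset.mem_range.1 i.2)
    simp only [Set.mem_preimage, this]
  rw [← integral_indicator hB', ← integral_indicator hB']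
  have hc := integral_coin (t := t)
    (f := fun s b => B.indicator (fun s => walkStep ε (walk ε s t) b) s) ?_
  · have e1 : (fun s => B.indicator (fun s => walkStep ε (walk ε s t) (s t)) s)
        = fun s => B.indicator (fun s' => walkStep ε (walk ε s' t) (s t)) s := by
      funext s; by_cases h : s ∈ B <;> simp [h]
    have e2 : ∀ s, (B.indicator (fun s => walkStep ε (walk ε s t) true) s
        + B.indicator (fun s => walkStep ε (walk ε s t) false) s) / 2
          = B.indicator (fun s => walk ε s t) s := by
      intro s; by_cases h : s ∈ B <;> simp [h, walkStep_average]
    simp only [walk_succ]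
    rw [e1, hc]
    simp only [e2]
  · intro b x y h
    have h1 : walk ε x t = walk ε y t := dependsOn_walk ε t h
    have h2 := hdep x y fun i hi => h i (by simpa using hi)
    by_cases hx : x ∈ B
    · simp [hx, h2.1 hx, h1]
    · have hy : y ∉ B := fun hy => hx (h2.2 hy)
      simp [hx, hy]

lemma isStochasticBuyer_walk {ε : ℝ} (hε : 0 < ε) :
    IsStochasticBuyer coinFlips coinFiltration ε fun t s => walk ε s t :=
  ⟨fun _ => ae_of_all _ fun _ => walk_mem_Icc hε _ _, martingale_walk ε,
    fun _ => ae_of_all _ fun _ => abs_walkStep_sub_le hε _ _⟩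

/-- The walk stays away from `0` and `1` with a probability bounded below for `O(ε⁻²)` steps. -/
lemma cos_pow_le_integral_sin_walk {ε : ℝ} (hε : 0 < ε) (hε1 : ε ≤ 1 / 2) (t : ℕ) :
    Real.cos (Real.pi * ε) ^ t ≤ ∫ s, Real.sin (Real.pi * walk ε s t) ∂coinFlips := by
  have hπ := Real.pi_pos
  have hcos : 0 ≤ Real.cos (Real.pi * ε) :=
    Real.cos_nonneg_of_neg_pi_div_two_le_of_le (by nlinarith) (by nlinarith)
  have hdep : ∀ t, DependsOn (fun s => Real.sin (Real.pi * walk ε s t))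
      (Finset.range t : Finset ℕ) := fun t x y h => by
    have : walk ε x t = walk ε y t := dependsOn_walk ε t h
    simp only [this]
  induction t with
  | zero => simp [walk, ← div_eq_mul_inv]
  | succ t ih =>
    have hd : ∀ b, DependsOn (fun s => Real.sin (Real.pi * walkStep ε (walk ε s t) b))
        (Finset.range t : Finset ℕ) := fun b x y h => by
      have : walk ε x t = walk ε y t := dependsOn_walk ε t h
      simp only [this]
    simp only [walk_succ]
    rw [integral_coin (f := fun s b => Real.sin (Real.pi * walkStep ε (walk ε s t) b)) hd, pow_succ,
      mul_comm]
    refine (mul_le_mul_of_nonneg_left ih hcos).trans ?_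
    rw [← integral_const_mul]
    refine integral_mono ((hdep t).integrable_of_finset.const_mul _)
      (((hd true).integrable_of_finset.add (hd false).integrable_of_finset).div_const 2) fun s => ?_
    have hw := walk_mem_Icc hε s t
    simp only
    unfold walkStep
    -- A moving walk multiplies the mean of `sin (π x)` by exactly `cos (π ε)`. A stopped walk keeps
    -- the value, which is no less because the sine is nonnegative on `[0, π]`.
    by_cases h : ε ≤ walk ε s t ∧ walk ε s t ≤ 1 - ε
    · rw [if_pos h, if_pos h, if_pos rfl, if_neg (by simp)]
      rw [mul_add, mul_add, mul_neg, Real.sin_add, Real.sin_add, Real.sin_neg, Real.cos_neg]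
      apply le_of_eq; ring
    · rw [if_neg h, if_neg h]
      have h0 : 0 ≤ Real.sin (Real.pi * walk ε s t) :=
        Real.sin_nonneg_of_nonneg_of_le_pi (mul_nonneg hπ.le hw.1)
          (mul_le_of_le_one_right hπ.le hw.2)
      have := Real.cos_le_one (Real.pi * ε)
      nlinarith

lemma walk_central_probability {ε δ K : ℝ} (hε : 0 < ε) (hε1 : ε ≤ 1 / 4) {t : ℕ}
    (ht : (t : ℝ) * ε ^ 2 ≤ K) (hδ : 0 ≤ δ) :
    Real.exp (-10 * K) - Real.pi * δ
      ≤ coinFlips.real {s | walk ε s t ∈ Set.Icc δ (1 - δ)} := by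
  have hπ := Real.pi_pos
  have hmeas : MeasurableSet {s | walk ε s t ∈ Set.Icc δ (1 - δ)} :=
    measurable_walk ε t measurableSet_Icc
  have h1 : Real.exp (-10 * K) ≤ Real.cos (Real.pi * ε) ^ t := by
    -- From `π ^ 2 ≤ 10`, the cosine is at least `1 - 5 * ε ^ 2`, and `(1 - 5 * ε ^ 2) * (1 + 10 * ε
    -- ^ 2) ≥ 1` for `ε ≤ 1 / 4`.
    have hc : Real.exp (-10 * ε ^ 2) ≤ Real.cos (Real.pi * ε) := by
      have c1 := Real.one_sub_sq_div_two_le_cos (x := Real.pi * ε)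
      have c2 : Real.pi ^ 2 ≤ 10 := by nlinarith [Real.pi_lt_d2]
      have c3 : 1 - 5 * ε ^ 2 ≤ Real.cos (Real.pi * ε) := by nlinarith [sq_nonneg ε]
      refine le_trans ?_ c3
      have c4 := Real.add_one_le_exp (10 * ε ^ 2)
      rw [show -10 * ε ^ 2 = -(10 * ε ^ 2) by ring, Real.exp_neg,
        inv_le_iff_one_le_mul₀ (Real.exp_pos _)]
      have c5 : 0 ≤ 1 - 5 * ε ^ 2 := by nlinarith
      refine le_trans ?_ (mul_le_mul_of_nonneg_left c4 c5)
      nlinarith [mul_nonneg (sq_nonneg ε) (show 0 ≤ 1 / 16 - ε ^ 2 by nlinarith)]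
    calc Real.exp (-10 * K) ≤ Real.exp (-10 * ε ^ 2) ^ t := by
          rw [← Real.exp_nat_mul, Real.exp_le_exp]; linarith
      _ ≤ _ := by gcongr
  have h2 := h1.trans (cos_pow_le_integral_sin_walk hε (by linarith) t)
  -- The sine is at most `1` in the central region and at most `π δ` within `δ` of the boundary.
  have h3 : ∫ s, Real.sin (Real.pi * walk ε s t) ∂coinFlips
      ≤ ∫ s, ({s | walk ε s t ∈ Set.Icc δ (1 - δ)}.indicator (fun _ => (1 : ℝ)) s
          + Real.pi * δ) ∂coinFlips := by
    have hm := measurable_walk ε t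
    refine integral_mono (Integrable.of_bound (by fun_prop) 1 (ae_of_all _ fun s => ?_))
      (((integrable_const 1).indicator hmeas).add (integrable_const _)) fun s => ?_
    · exact Real.abs_sin_le_one _
    · have hw := walk_mem_Icc hε s t
      have hδπ : 0 ≤ Real.pi * δ := by positivity
      by_cases h : walk ε s t ∈ Set.Icc δ (1 - δ)
      · simp only [Set.mem_ofPred_eq, h, Set.indicator_of_mem]
        linarith [Real.sin_le_one (Real.pi * walk ε s t)]
      · simp only [Set.mem_ofPred_eq, h, not_false_eq_true, Set.indicator_of_notMem, zero_add]
        rw [Set.mem_Icc, not_and_or, not_le, not_le] at h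
        rcases h with h | h
        · exact (Real.sin_le (mul_nonneg hπ.le hw.1)).trans (by gcongr)
        · rw [← Real.sin_pi_sub]
          refine (Real.sin_le ?_).trans ?_ <;> nlinarith [hw.2]
  rw [integral_add ((integrable_const 1).indicator hmeas) (integrable_const _),
    integral_indicator_const _ hmeas] at h3
  simp only [smul_eq_mul, mul_one, integral_const, probReal_univ, one_mul] at h3
  linarith

/-! ### The seller and the walk as a Markov chain -/

/-- One step of the pair of the observed signals and the current value. -/
noncomputable def chainStep (A : Seller) (ε : ℝ) (z : List Bool × ℝ) (b : Bool) : List Bool × ℝ :=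
  (decide ((A z.1 : ℝ) ≤ z.2) :: z.1, walkStep ε z.2 b)

/-- The chain started in `z` and driven by the coin flips `s`. -/
noncomputable def chain (A : Seller) (ε : ℝ) (z : List Bool × ℝ) (s : ℕ → Bool) : ℕ → List Bool × ℝ
  | 0 => z
  | t + 1 => chainStep A ε (chain A ε z s t) (s t)

/-- The loss in the state `z`. -/
noncomputable def stateLoss (A : Seller) (z : List Bool × ℝ) : ℝ :=
  z.2 - if (A z.1 : ℝ) ≤ z.2 then (A z.1 : ℝ) else 0

/-- The transition operator of the chain. -/
noncomputable def chainAvg (A : Seller) (ε : ℝ) (F : List Bool × ℝ → ℝ) (z : List Bool × ℝ) : ℝ :=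
  (F (chainStep A ε z true) + F (chainStep A ε z false)) / 2

variable {A : Seller} {ε : ℝ}

lemma chain_eq_signals (s : ℕ → Bool) (t : ℕ) :
    chain A ε ([], 1 / 2) s t = (signals A (walk ε s) t, walk ε s t) := by
  induction t with
  | zero => rfl
  | succ t ih => rw [chain, ih]; rfl

lemma stateLoss_chain (s : ℕ → Bool) (t : ℕ) :
    stateLoss A (chain A ε ([], 1 / 2) s t) = walk ε s t - revenueAt A (walk ε s) t := by
  rw [chain_eq_signals]; rfl

lemma dependsOn_chain (A : Seller) (ε : ℝ) (z : List Bool × ℝ) (t : ℕ) :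
    DependsOn (fun s => chain A ε z s t) (Finset.range t : Finset ℕ) := by
  induction t with
  | zero => intro x y _; rfl
  | succ t ih =>
    intro x y h
    have h1 : chain A ε z x t = chain A ε z y t := ih fun i hi => h i (by simp at hi ⊢; omega)
    simp only [chain]
    rw [h1, h t (by simp)]

lemma dependsOn_comp_chain {β : Type*} (F : List Bool × ℝ → β) (z : List Bool × ℝ) (t : ℕ) :
    DependsOn (fun s => F (chain A ε z s t)) (Finset.range t : Finset ℕ) :=
  fun _ _ h => congrArg F (dependsOn_chain A ε z t h)

lemma integrable_comp_chain (F : List Bool × ℝ → ℝ) (z : List Bool × ℝ) (t : ℕ) :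
    Integrable (fun s => F (chain A ε z s t)) coinFlips :=
  (dependsOn_comp_chain F z t).integrable_of_finset

/-- Expectations become iterates of `chainAvg`, so the Markov property reduces to the semigroup law
of iteration and needs no conditional expectations. -/
lemma integral_comp_chain (F : List Bool × ℝ → ℝ) (z : List Bool × ℝ) (t : ℕ) :
    ∫ s, F (chain A ε z s t) ∂coinFlips = (chainAvg A ε)^[t] F z := by
  induction t generalizing F with
  | zero => simp [chain]
  | succ t ih =>
    simp only [chain]
    rw [integral_coin (f := fun s b => F (chainStep A ε (chain A ε z s t) b))
      fun b => dependsOn_comp_chain (fun z => F (chainStep A ε z b)) z t]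
    exact ih (chainAvg A ε F)

/-- The Markov property. -/
lemma integral_chain_add (F : List Bool × ℝ → ℝ) (z : List Bool × ℝ) (a t : ℕ) :
    ∫ s, F (chain A ε z s (a + t)) ∂coinFlips
      = ∫ s, ∫ w, F (chain A ε (chain A ε z s a) w t) ∂coinFlips ∂coinFlips := by
  have h : ∀ z, ∫ w, F (chain A ε z w t) ∂coinFlips = (chainAvg A ε)^[t] F z :=
    fun z => integral_comp_chain F z t
  simp only [h]
  rw [integral_comp_chain F z (a + t), integral_comp_chain _ z a, Function.iterate_add_apply]

/-! ### Simple random walk -/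

/-- The simple random walk on the integers. -/
def simpleWalk (w : ℕ → Bool) : ℕ → ℝ
  | 0 => 0
  | t + 1 => simpleWalk w t + if w t then 1 else -1

lemma dependsOn_simpleWalk (t : ℕ) :
    DependsOn (fun w => simpleWalk w t) (Finset.range t : Finset ℕ) := by
  induction t with
  | zero => intro x y _; rfl
  | succ t ih =>
    intro x y h
    have h1 : simpleWalk x t = simpleWalk y t := ih fun i hi => h i (by simp at hi ⊢; omega)
    simp only [simpleWalk]
    rw [h1, h t (by simp)]

lemma dependsOn_comp_simpleWalk (F : ℝ → ℝ) (t : ℕ) :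
    DependsOn (fun w => F (simpleWalk w t)) (Finset.range t : Finset ℕ) :=
  fun _ _ h => congrArg F (dependsOn_simpleWalk t h)

lemma integrable_comp_simpleWalk (F : ℝ → ℝ) (t : ℕ) :
    Integrable (fun w => F (simpleWalk w t)) coinFlips :=
  (dependsOn_comp_simpleWalk F t).integrable_of_finset

lemma abs_simpleWalk_le (w : ℕ → Bool) (t : ℕ) : |simpleWalk w t| ≤ t := by
  induction t with
  | zero => simp [simpleWalk]
  | succ t ih =>
    simp only [simpleWalk]
    refine (abs_add_le _ _).trans ?_
    push_cast
    gcongr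
    split_ifs <;> simp

lemma integral_simpleWalk_succ (F : ℝ → ℝ) (t : ℕ) :
    ∫ w, F (simpleWalk w (t + 1)) ∂coinFlips
      = ∫ w, (F (simpleWalk w t + 1) + F (simpleWalk w t - 1)) / 2 ∂coinFlips := by
  simp only [simpleWalk]
  rw [integral_coin (f := fun w b => F (simpleWalk w t + if b then 1 else -1))
    fun b => dependsOn_comp_simpleWalk (fun x => F (x + if b then 1 else -1)) t]
  simp [sub_eq_add_neg]

lemma integral_simpleWalk (t : ℕ) : ∫ w, simpleWalk w t ∂coinFlips = 0 := by
  induction t with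
  | zero => simp [simpleWalk]
  | succ t ih =>
    rw [integral_simpleWalk_succ fun x => x]
    simpa using ih

lemma integral_simpleWalk_sq (t : ℕ) : ∫ w, simpleWalk w t ^ 2 ∂coinFlips = t := by
  induction t with
  | zero => simp [simpleWalk]
  | succ t ih =>
    rw [integral_simpleWalk_succ fun x => x ^ 2]
    have : ∀ w, ((simpleWalk w t + 1) ^ 2 + (simpleWalk w t - 1) ^ 2) / 2
        = simpleWalk w t ^ 2 + 1 := fun w => by ring
    simp only [this]
    rw [integral_add (integrable_comp_simpleWalk (fun x => x ^ 2) t) (integrable_const _), ih]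
    simp

lemma integral_simpleWalk_pow_four_le (t : ℕ) :
    ∫ w, simpleWalk w t ^ 4 ∂coinFlips ≤ 3 * t ^ 2 := by
  induction t with
  | zero => simp [simpleWalk]
  | succ t ih =>
    rw [integral_simpleWalk_succ fun x => x ^ 4]
    have : ∀ w, ((simpleWalk w t + 1) ^ 4 + (simpleWalk w t - 1) ^ 4) / 2
        = simpleWalk w t ^ 4 + (6 * simpleWalk w t ^ 2 + 1) := fun w => by ring
    simp only [this]
    rw [integral_add (integrable_comp_simpleWalk (fun x => x ^ 4) t)
        (integrable_comp_simpleWalk (fun x => 6 * x ^ 2 + 1) t),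
      integral_add (integrable_comp_simpleWalk (fun x => 6 * x ^ 2) t) (integrable_const _),
      integral_const_mul, integral_simpleWalk_sq]
    simp only [integral_const, probReal_univ, smul_eq_mul, mul_one]
    push_cast
    linarith

/-- Anticoncentration of a centred random variable from its second and fourth moments. -/
lemma one_div_forty_le_measureReal {Ω : Type*} {mΩ : MeasurableSpace Ω} {μ : Measure Ω}
    [IsProbabilityMeasure μ] {Y : Ω → ℝ} (hY : Measurable Y) {r : ℝ} (hr : 0 < r)
    (h1 : Integrable Y μ) (h2 : Integrable (fun ω => Y ω ^ 2) μ)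
    (h4 : Integrable (fun ω => Y ω ^ 4) μ) (m1 : ∫ ω, Y ω ∂μ = 0)
    (m2 : ∫ ω, Y ω ^ 2 ∂μ = r ^ 2) (m4 : ∫ ω, Y ω ^ 4 ∂μ ≤ 3 * r ^ 4) :
    1 / 40 ≤ μ.real {ω | r / 10 ≤ Y ω} := by
  have hB : MeasurableSet {ω | r / 10 ≤ Y ω} := measurableSet_le measurable_const hY
  -- With `y = Y / r`, this quartic lies below the indicator of `y ≥ 1 / 10`. Its mean is at least
  -- `1/8 - 3/64 - 1/20 = 9/320`, which exceeds `1/40`.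
  set f : Ω → ℝ := fun ω => (1 / 8 / r ^ 2) * Y ω ^ 2 - (1 / 64 / r ^ 4) * Y ω ^ 4
    + (1 / 4 / r) * Y ω - 1 / 20 with hf
  have hle : ∫ ω, f ω ∂μ ≤ ∫ ω, {ω | r / 10 ≤ Y ω}.indicator (fun _ => (1 : ℝ)) ω ∂μ := by
    refine integral_mono ((((h2.const_mul _).sub (h4.const_mul _)).add (h1.const_mul _)).sub
      (integrable_const _)) ((integrable_const 1).indicator hB) fun ω => ?_
    obtain ⟨y, hy⟩ : ∃ y, Y ω = r * y := ⟨Y ω / r, by field_simp⟩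
    have hfy : f ω = 1 / 8 * y ^ 2 - 1 / 64 * y ^ 4 + 1 / 4 * y - 1 / 20 := by
      simp only [hf, hy]; field_simp
    rw [hfy]
    by_cases h : r / 10 ≤ Y ω
    · simp only [Set.mem_ofPred_eq, h, Set.indicator_of_mem]
      nlinarith [sq_nonneg (y ^ 2 - 6), sq_nonneg (y - 2)]
    · simp only [Set.mem_ofPred_eq, h, not_false_eq_true, Set.indicator_of_notMem]
      have hy1 : y < 1 / 10 := by
        rw [hy] at h
        by_contra! hc
        apply h
        nlinarith
      rcases le_total 0 y with h0 | h0
      · nlinarith [sq_nonneg (y ^ 2)]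
      -- Positivity of the cubic factor comes from `16 + 8y - y³ = -y (y + 2)² + (2y + 3)² + 7`.
      · have : 0 ≤ (-y) * (16 + 8 * y - y ^ 3) := by
          refine mul_nonneg (by linarith) ?_
          nlinarith [mul_nonneg (neg_nonneg.2 h0) (sq_nonneg (y + 2)), sq_nonneg (2 * y + 3)]
        nlinarith
  rw [integral_indicator_const _ hB] at hle
  simp only [smul_eq_mul, mul_one] at hle
  refine le_trans ?_ hle
  have i2 := h2.const_mul (1 / 8 / r ^ 2)
  have i4 := h4.const_mul (1 / 64 / r ^ 4)
  have i1 := h1.const_mul (1 / 4 / r)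
  have e : ∫ ω, f ω ∂μ = 1 / 8 / r ^ 2 * r ^ 2 - 1 / 64 / r ^ 4 * ∫ ω, Y ω ^ 4 ∂μ - 1 / 20 := by
    have a1 := integral_sub ((i2.sub i4).add i1) (integrable_const (1 / 20 : ℝ))
    have a2 := integral_add (i2.sub i4) i1
    simp only [Pi.add_apply, Pi.sub_apply] at a1 a2
    simp only [hf]
    rw [a1, a2, integral_sub i2 i4, integral_const_mul, integral_const_mul, integral_const_mul, m1, m2]
    simp
  have e4 : 1 / 64 / r ^ 4 * ∫ ω, Y ω ^ 4 ∂μ ≤ 1 / 64 / r ^ 4 * (3 * r ^ 4) := by gcongr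
  have e2 : 1 / 8 / r ^ 2 * r ^ 2 = 1 / 8 := by field_simp
  have e3 : 1 / 64 / r ^ 4 * (3 * r ^ 4) = 3 / 64 := by field_simp
  rw [e]
  linarith

lemma measurable_simpleWalk (t : ℕ) : Measurable fun w => simpleWalk w t :=
  (dependsOn_simpleWalk t).measurable_of_finset

lemma simpleWalk_ge_probability {t : ℕ} (ht : 0 < t) :
    1 / 40 ≤ coinFlips.real {w | √t / 10 ≤ simpleWalk w t} := by
  have ht' : (0 : ℝ) < t := by exact_mod_cast ht
  have h2 : √(t : ℝ) ^ 2 = t := Real.sq_sqrt ht'.le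
  refine one_div_forty_le_measureReal (measurable_simpleWalk t) (Real.sqrt_pos.2 ht')
    (integrable_comp_simpleWalk (fun x => x) t) (integrable_comp_simpleWalk (fun x => x ^ 2) t)
    (integrable_comp_simpleWalk (fun x => x ^ 4) t) (integral_simpleWalk t) ?_ ?_
  · rw [integral_simpleWalk_sq, h2]
  · rw [show √(t : ℝ) ^ 4 = (√(t : ℝ) ^ 2) ^ 2 by ring, h2]
    exact integral_simpleWalk_pow_four_le t

lemma simpleWalk_le_probability {t : ℕ} (ht : 0 < t) :
    1 / 40 ≤ coinFlips.real {w | √t / 10 ≤ -simpleWalk w t} := by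
  have ht' : (0 : ℝ) < t := by exact_mod_cast ht
  have h2 : √(t : ℝ) ^ 2 = t := Real.sq_sqrt ht'.le
  refine one_div_forty_le_measureReal (measurable_simpleWalk t).neg (Real.sqrt_pos.2 ht')
    (integrable_comp_simpleWalk (fun x => -x) t)
    (integrable_comp_simpleWalk (fun x => (-x) ^ 2) t)
    (integrable_comp_simpleWalk (fun x => (-x) ^ 4) t) ?_ ?_ ?_
  · simp only [Pi.neg_apply]
    rw [integral_neg, integral_simpleWalk, neg_zero]
  · simp only [Pi.neg_apply, neg_sq]
    rw [integral_simpleWalk_sq, h2]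
  · rw [show √(t : ℝ) ^ 4 = (√(t : ℝ) ^ 2) ^ 2 by ring, h2]
    simp only [Pi.neg_apply, (by decide : Even 4).neg_pow]
    exact integral_simpleWalk_pow_four_le t

/-! ### The loss in one window -/

variable {δ : ℝ}

lemma stateLoss_nonneg {z : List Bool × ℝ} (hz : 0 ≤ z.2) : 0 ≤ stateLoss A z := by
  unfold stateLoss
  split_ifs with h <;> linarith

/-- The price posted after `i` further sales. -/
noncomputable def salePrice (A : Seller) (h : List Bool) (i : ℕ) : ℝ :=
  A (List.replicate i true ++ h)

/-- The window is too short for the walk to reach the boundary from `[δ, 1 - δ]`, so the stopping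
rule never acts. -/
lemma chain_snd_eq (hε : 0 < ε) {z : List Bool × ℝ} (hz : z.2 ∈ Set.Icc δ (1 - δ)) {n : ℕ}
    (hn : (n : ℝ) * ε ≤ δ / 2) (w : ℕ → Bool) {i : ℕ} (hi : i ≤ n) :
    (chain A ε z w i).2 = z.2 + ε * simpleWalk w i := by
  induction i with
  | zero => simp [chain, simpleWalk]
  | succ i ih =>
    have ih := ih (by omega)
    have h1 : |ε * simpleWalk w i| ≤ i * ε := by
      rw [abs_mul, abs_of_pos hε, mul_comm]
      exact mul_le_mul_of_nonneg_right (abs_simpleWalk_le w i) hε.le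
    have h2 : ((i : ℝ) + 1) * ε ≤ n * ε := by gcongr; exact_mod_cast hi
    have h3 : (0 : ℝ) ≤ i * ε := by positivity
    obtain ⟨a1, a2⟩ := abs_le.1 h1
    obtain ⟨b1, b2⟩ := hz
    simp only [chain, chainStep, simpleWalk, walkStep, ih]
    rw [if_pos ⟨by linarith, by linarith⟩]
    split_ifs <;> ring

lemma chain_snd_ge (hε : 0 < ε) {z : List Bool × ℝ} (hz : z.2 ∈ Set.Icc δ (1 - δ)) {n : ℕ}
    (hn : (n : ℝ) * ε ≤ δ / 2) (w : ℕ → Bool) {i : ℕ} (hi : i ≤ n) :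
    δ / 2 ≤ (chain A ε z w i).2 := by
  rw [chain_snd_eq hε hz hn w hi]
  have h1 : |ε * simpleWalk w i| ≤ i * ε := by
    rw [abs_mul, abs_of_pos hε, mul_comm]
    exact mul_le_mul_of_nonneg_right (abs_simpleWalk_le w i) hε.le
  have h2 : (i : ℝ) * ε ≤ n * ε := by gcongr
  linarith [neg_abs_le (ε * simpleWalk w i), hz.1]

/-- As long as everything is sold, the history, and with it the next price, does not depend on the
coin flips. -/
lemma chain_fst_eq (hε : 0 < ε) {z : List Bool × ℝ} (hz : z.2 ∈ Set.Icc δ (1 - δ)) {n : ℕ}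
    (hn : (n : ℝ) * ε ≤ δ / 2) (w : ℕ → Bool) {i : ℕ} (hi : i ≤ n)
    (hs : ∀ j < i, salePrice A z.1 j ≤ z.2 + ε * simpleWalk w j) :
    (chain A ε z w i).1 = List.replicate i true ++ z.1 := by
  induction i with
  | zero => simp [chain]
  | succ i ih =>
    have ih := ih (by omega) fun j hj => hs j (by omega)
    have h := hs i (Nat.lt_succ_self i)
    rw [← chain_snd_eq (A := A) hε hz hn w (by omega), salePrice, ← ih] at h
    simp only [chain, chainStep, h, decide_true, List.replicate_succ, List.cons_append]
    rw [ih]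

/-- The loss in a window in which not every price is accepted. -/
lemma le_sum_stateLoss_of_no_sale (hε : 0 < ε) {z : List Bool × ℝ}
    (hz : z.2 ∈ Set.Icc δ (1 - δ)) {n : ℕ} (hn : (n : ℝ) * ε ≤ δ / 2) (w : ℕ → Bool)
    (hδ : 0 ≤ δ)
    (h : ¬ ∀ j < n, salePrice A z.1 j ≤ z.2 + ε * simpleWalk w j) :
    δ / 2 ≤ ∑ i ∈ Finset.range n, stateLoss A (chain A ε z w i) := by
  classical
  have hex : ∃ j, j < n ∧ ¬ salePrice A z.1 j ≤ z.2 + ε * simpleWalk w j := by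
    push Not at h ⊢; exact h
  obtain ⟨hj, hns⟩ := Nat.find_spec hex
  set j := Nat.find hex with hjdef
  have hs : ∀ i < j, salePrice A z.1 i ≤ z.2 + ε * simpleWalk w i := fun i hi => by
    have := Nat.find_min hex hi
    by_contra hc
    exact this ⟨by omega, hc⟩
  have hfst := chain_fst_eq hε hz hn w hj.le hs
  have hloss : stateLoss A (chain A ε z w j) = (chain A ε z w j).2 := by
    rw [← chain_snd_eq (A := A) hε hz hn w hj.le, salePrice, ← hfst] at hns
    rw [stateLoss, if_neg hns, sub_zero]
  have hnn : ∀ i ∈ Finset.range n, 0 ≤ stateLoss A (chain A ε z w i) := fun i hi =>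
    stateLoss_nonneg ((by linarith : (0 : ℝ) ≤ δ / 2).trans
      (chain_snd_ge hε hz hn w (Finset.mem_range.1 hi).le))
  exact (chain_snd_ge hε hz hn w hj.le).trans
    (hloss.symm.le.trans (Finset.single_le_sum hnn (Finset.mem_range.2 hj)))

/-- In every window of length about `ε ^ (-2/3)` the seller loses a constant: either some price is
rejected with constant probability, or the prices are too low for half of the window. -/
lemma le_integral_window (A : Seller) (hε : 0 < ε) {z : List Bool × ℝ} (hδ : 0 < δ)
    (hz : z.2 ∈ Set.Icc δ (1 - δ)) {k : ℕ} (hk : 0 < k)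
    (hn : ((2 * k : ℕ) : ℝ) * ε ≤ δ / 2) (hkε : 1 / 8 ≤ ε * (k * √k)) :
    δ / 6400 ≤ ∫ w, ∑ i ∈ Finset.range (2 * k), stateLoss A (chain A ε z w i) ∂coinFlips := by
  set n := 2 * k with hndef
  set N : Set (ℕ → Bool) := {w | ∀ j < n, salePrice A z.1 j ≤ z.2 + ε * simpleWalk w j} with hN
  have hNm : MeasurableSet N := by
    have : N = ⋂ j, ⋂ (_ : j < n), {w | salePrice A z.1 j ≤ z.2 + ε * simpleWalk w j} := by
      ext w; simp [hN]
    rw [this]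
    exact MeasurableSet.iInter fun j => MeasurableSet.iInter fun _ =>
      measurableSet_le measurable_const (((measurable_simpleWalk j).const_mul ε).const_add _)
  have hδ1 : δ ≤ 1 / 2 := by linarith [hz.1, hz.2]
  have hint : ∀ i, Integrable (fun w => stateLoss A (chain A ε z w i)) coinFlips :=
    fun i => integrable_comp_chain _ z i
  have hnn : ∀ w, ∀ i < n, 0 ≤ stateLoss A (chain A ε z w i) := fun w i hi =>
    stateLoss_nonneg ((by linarith : (0 : ℝ) ≤ δ / 2).trans (chain_snd_ge hε hz hn w hi.le))
  have hsum : Integrable (fun w => ∑ i ∈ Finset.range n, stateLoss A (chain A ε z w i))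
    coinFlips := integrable_finsetSum _ fun i _ => hint i
  -- the loss from rejections
  have hrej : δ / 2 * coinFlips.real Nᶜ
      ≤ ∫ w, ∑ i ∈ Finset.range n, stateLoss A (chain A ε z w i) ∂coinFlips := by
    have h : ∫ w, Nᶜ.indicator (fun _ => δ / 2) w ∂coinFlips
        ≤ ∫ w, ∑ i ∈ Finset.range n, stateLoss A (chain A ε z w i) ∂coinFlips := by
      refine integral_mono ((integrable_const _).indicator hNm.compl) hsum fun w => ?_
      by_cases hw : w ∈ Nᶜ
      · rw [Set.indicator_of_mem hw]
        exact le_sum_stateLoss_of_no_sale hε hz hn w hδ.le hw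
      · rw [Set.indicator_of_notMem hw]
        exact Finset.sum_nonneg fun i hi => hnn w i (Finset.mem_range.1 hi)
    rwa [integral_indicator_const _ hNm.compl, smul_eq_mul, mul_comm] at h
  -- The threshold is half of the anticoncentration constant `1 / 40`, so that an upward move
  -- without any rejection keeps probability `1 / 80`.
  by_cases hq : 1 / 80 ≤ coinFlips.real Nᶜ
  · refine le_trans ?_ hrej
    nlinarith
  push Not at hq
  -- in this case the prices are low in the second half
  have hlow : ∀ i, k ≤ i → i < n → salePrice A z.1 i ≤ z.2 - ε * (√i / 10) := by
    intro i hi hin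
    by_contra! hc
    -- A higher price would be rejected on every downward move, which has probability at least `1 /
    -- 40`.
    have hsub : {w | √(i : ℝ) / 10 ≤ -simpleWalk w i} ⊆ Nᶜ := by
      intro w hw hwN
      have h1 := hwN i hin
      have hw' : √(i : ℝ) / 10 ≤ -simpleWalk w i := hw
      have := mul_le_mul_of_nonneg_left hw' hε.le
      linarith
    have := (simpleWalk_le_probability (hk.trans_le hi)).trans
      (measureReal_mono hsub)
    linarith
  have hstep : ∀ i, k ≤ i → i < n →
      ε * √k / 800 ≤ ∫ w, stateLoss A (chain A ε z w i) ∂coinFlips := by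
    intro i hi hin
    set E : Set (ℕ → Bool) := {w | √(i : ℝ) / 10 ≤ simpleWalk w i} with hE
    have hEm : MeasurableSet E := measurableSet_le measurable_const (measurable_simpleWalk i)
    have hprob : 1 / 80 ≤ coinFlips.real (E ∩ N) := by
      have h1 := simpleWalk_ge_probability (hk.trans_le hi)
      have h2 : coinFlips.real E ≤ coinFlips.real ((E ∩ N) ∪ Nᶜ) :=
        measureReal_mono fun w hw => by
          by_cases h : w ∈ N
          · exact Or.inl ⟨hw, h⟩
          · exact Or.inr h
      have h3 := measureReal_union_le (μ := coinFlips) (E ∩ N) Nᶜ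
      linarith
    have hsq : √(k : ℝ) ≤ √(i : ℝ) := Real.sqrt_le_sqrt (by exact_mod_cast hi)
    have h : ∫ w, (E ∩ N).indicator (fun _ => ε * √k / 10) w ∂coinFlips
        ≤ ∫ w, stateLoss A (chain A ε z w i) ∂coinFlips := by
      refine integral_mono ((integrable_const _).indicator (hEm.inter hNm)) (hint i) fun w => ?_
      by_cases hw : w ∈ E ∩ N
      · rw [Set.indicator_of_mem hw]
        have hsale := hw.2 i hin
        have hfst := chain_fst_eq hε hz hn w hin.le fun j hj => hw.2 j (hj.trans hin)
        have hsnd := chain_snd_eq (A := A) hε hz hn w hin.le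
        have hloss : stateLoss A (chain A ε z w i)
            = z.2 + ε * simpleWalk w i - salePrice A z.1 i := by
          rw [stateLoss, hfst, hsnd]
          exact congrArg _ (if_pos hsale)
        rw [hloss]
        have hwE : √(i : ℝ) / 10 ≤ simpleWalk w i := hw.1
        have a1 := hlow i hi hin
        have a2 := mul_le_mul_of_nonneg_left hwE hε.le
        have a3 := mul_le_mul_of_nonneg_left hsq hε.le
        have a4 : 0 ≤ ε * √(i : ℝ) := by positivity
        linarith
      · rw [Set.indicator_of_notMem hw]
        exact hnn w i hin
    rw [integral_indicator_const _ (hEm.inter hNm), smul_eq_mul] at h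
    have : 0 ≤ ε * √(k : ℝ) / 10 := by positivity
    nlinarith
  rw [integral_finsetSum _ fun i _ => hint i]
  calc δ / 6400 ≤ k * (ε * √k / 800) := by nlinarith
    _ = ∑ i ∈ Finset.Ico k n, ε * √k / 800 := by
        rw [Finset.sum_const, Nat.card_Ico, nsmul_eq_mul, hndef, show 2 * k - k = k by omega]
    _ ≤ ∑ i ∈ Finset.Ico k n, ∫ w, stateLoss A (chain A ε z w i) ∂coinFlips :=
        Finset.sum_le_sum fun i hi => hstep i (Finset.mem_Ico.1 hi).1 (Finset.mem_Ico.1 hi).2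
    _ ≤ _ := by
        refine Finset.sum_le_sum_of_subset_of_nonneg (fun i hi => ?_) fun i hi _ => ?_
        · exact Finset.mem_range.2 (Finset.mem_Ico.1 hi).2
        · exact integral_nonneg fun w => hnn w i (Finset.mem_range.1 hi)

/-! ### The lower bound over the whole horizon -/

lemma chain_snd_mem_Icc {A : Seller} {ε : ℝ} (hε : 0 < ε) {z : List Bool × ℝ}
    (hz : z.2 ∈ Set.Icc (0 : ℝ) 1) (s : ℕ → Bool) (t : ℕ) :
    (chain A ε z s t).2 ∈ Set.Icc (0 : ℝ) 1 := by
  induction t with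
  | zero => exact hz
  | succ t ih => exact walkStep_mem_Icc ih _ hε

/-- The window bound holds for every history, so it can be integrated over the random state at time
`a`; starts near the boundary are dropped because losses are nonnegative. -/
lemma le_integral_window_walk (A : Seller) {ε δ p : ℝ} (hε : 0 < ε) (hδ : 0 < δ) {a k : ℕ}
    (hk : 0 < k) (hn : ((2 * k : ℕ) : ℝ) * ε ≤ δ / 2) (hkε : 1 / 8 ≤ ε * (k * √k))
    (hp : p ≤ coinFlips.real {s | walk ε s a ∈ Set.Icc δ (1 - δ)}) :
    δ / 6400 * p ≤ ∑ i ∈ Finset.range (2 * k),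
      ∫ s, (walk ε s (a + i) - revenueAt A (walk ε s) (a + i)) ∂coinFlips := by
  have hm : MeasurableSet {s | walk ε s a ∈ Set.Icc δ (1 - δ)} :=
    measurable_walk ε a measurableSet_Icc
  set z₀ : List Bool × ℝ := ([], 1 / 2) with hz₀
  set J : List Bool × ℝ → ℝ := fun z =>
    ∑ i ∈ Finset.range (2 * k), ∫ w, stateLoss A (chain A ε z w i) ∂coinFlips with hJ
  have hsum : ∑ i ∈ Finset.range (2 * k),
      ∫ s, (walk ε s (a + i) - revenueAt A (walk ε s) (a + i)) ∂coinFlips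
        = ∫ s, J (chain A ε z₀ s a) ∂coinFlips := by
    rw [hJ, integral_finsetSum]
    · refine Finset.sum_congr rfl fun i _ => ?_
      rw [← integral_chain_add]
      simp only [hz₀, stateLoss_chain]
    · intro i _
      exact integrable_comp_chain (fun z => ∫ w, stateLoss A (chain A ε z w i) ∂coinFlips) z₀ a
  have hsnd : ∀ s, (chain A ε z₀ s a).2 = walk ε s a := fun s => by
    rw [hz₀, chain_eq_signals]
  rw [hsum]
  have h : ∫ s, {s | walk ε s a ∈ Set.Icc δ (1 - δ)}.indicator (fun _ => δ / 6400) s ∂coinFlips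
      ≤ ∫ s, J (chain A ε z₀ s a) ∂coinFlips := by
    refine integral_mono ((integrable_const _).indicator hm) (integrable_comp_chain J z₀ a)
      fun s => ?_
    by_cases hs : s ∈ {s | walk ε s a ∈ Set.Icc δ (1 - δ)}
    · rw [Set.indicator_of_mem hs]
      have hw := le_integral_window A hε (z := chain A ε z₀ s a) hδ (by rw [hsnd]; exact hs) hk hn
        hkε
      rwa [integral_finsetSum _ fun i _ => integrable_comp_chain _ _ i] at hw
    · rw [Set.indicator_of_notMem hs]
      refine Finset.sum_nonneg fun i _ => integral_nonneg fun w => stateLoss_nonneg ?_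
      exact (chain_snd_mem_Icc hε (by rw [hsnd]; exact walk_mem_Icc hε s a) w i).1
  rw [integral_indicator_const _ hm, smul_eq_mul] at h
  refine le_trans ?_ h
  rw [mul_comm]
  gcongr

lemma nat_mul_le_sum_range_mul {f : ℕ → ℝ} {c : ℝ} {W : ℕ} (M : ℕ)
    (h : ∀ b < M, c ≤ ∑ i ∈ Finset.range W, f (b * W + i)) :
    M * c ≤ ∑ t ∈ Finset.range (M * W), f t := by
  induction M with
  | zero => simp
  | succ M ih =>
    rw [Nat.succ_mul, Finset.sum_range_add]
    have h1 := ih fun b hb => h b (by omega)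
    have h2 := h M (Nat.lt_succ_self M)
    push_cast
    linarith

/-- The lower bound for deterministic sellers. -/
lemma le_integral_revenueLoss_walk {K ε : ℝ} (hε : 0 < ε) (hε8 : ε ≤ 1 / 8)
    (hεK : ε ≤ (Real.exp (-10 * K) / 16) ^ 3) {T : ℕ} (hT1 : ε ^ (-(2 / 3) : ℝ) ≤ (T : ℝ))
    (hT2 : (T : ℝ) ≤ K * ε ^ (-2 : ℝ)) (A : Seller) :
    Real.exp (-10 * K) ^ 2 / 204800 * ε ^ (2 / 3 : ℝ)
      ≤ ∫ s, revenueLoss A (walk ε s) T ∂coinFlips := by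
  set e := Real.exp (-10 * K) with he
  have he0 : 0 < e := Real.exp_pos _
  set u := ε ^ (1 / 3 : ℝ) with hu
  have hu0 : 0 < u := Real.rpow_pos_of_pos hε _
  have hu3 : u ^ 3 = ε := by
    rw [hu, ← Real.rpow_natCast, ← Real.rpow_mul hε.le]; norm_num
  have hu2 : ε ^ (2 / 3 : ℝ) = u ^ 2 := by
    rw [hu, ← Real.rpow_natCast, ← Real.rpow_mul hε.le]; norm_num
  rw [Real.rpow_neg hε.le, hu2] at hT1
  rw [hu2]
  have hu_half : u ≤ 1 / 2 := le_of_pow_le_pow_left₀ (n := 3) (by norm_num) (by norm_num)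
    (by rw [hu3]; linarith)
  have hu_e : u ≤ e / 16 := le_of_pow_le_pow_left₀ (n := 3) (by norm_num) (by positivity)
    (by rw [hu3]; exact hεK)
  set X := (u ^ 2)⁻¹ with hX
  have hX4 : 4 ≤ X := by
    rw [hX, le_inv_comm₀ (by norm_num) (by positivity)]
    nlinarith
  -- Rounding down gives `2 * k ≤ X ≤ T`, so one window fits even into the shortest horizon; `X ≥ 4`
  -- keeps `k ≥ X / 4`.
  set k := ⌊X / 2⌋₊ with hk
  have hk1 : (k : ℝ) ≤ X / 2 := Nat.floor_le (by linarith)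
  have hk2 : X / 4 ≤ k := by
    have := Nat.lt_floor_add_one (X / 2)
    linarith
  have hk0 : 0 < k := by
    have : (0 : ℝ) < k := by linarith
    exact_mod_cast this
  have hXu : X * u ^ 2 = 1 := inv_mul_cancel₀ (by positivity)
  have hn : ((2 * k : ℕ) : ℝ) * ε ≤ e / 8 / 2 := by
    push_cast
    calc 2 * (k : ℝ) * ε ≤ X * ε := by gcongr; linarith
      _ = u := by rw [← hu3]; linear_combination u * hXu
      _ ≤ _ := by linarith
  have hkε : 1 / 8 ≤ ε * (k * √k) := by
    have h1 : (1 / (2 * u)) ≤ √(k : ℝ) := by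
      apply Real.le_sqrt_of_sq_le
      refine le_trans (le_of_eq ?_) hk2
      rw [hX]; field_simp; norm_num
    calc (1 / 8 : ℝ) = ε * (X / 4 * (1 / (2 * u))) := by
          rw [← hu3, hX]; field_simp; norm_num
      _ ≤ _ := by gcongr
  have hT0 : (0 : ℝ) < T := by linarith
  have hTK : (T : ℝ) * ε ^ 2 ≤ K := by
    rw [Real.rpow_neg hε.le, Real.rpow_two, ← div_eq_mul_inv, le_div_iff₀ (by positivity)] at hT2
    exact hT2
  set W := 2 * k with hW
  have hWX : (W : ℝ) ≤ X := by rw [hW]; push_cast; linarith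
  have hW0 : (0 : ℝ) < W := by rw [hW]; positivity
  set M := T / W with hM
  have hMW : M * W ≤ T := Nat.div_mul_le_self T W
  have hM1 : 1 ≤ M := by
    rw [hM, Nat.one_le_div_iff (by omega)]
    exact_mod_cast hWX.trans hT1
  have hMT : (T : ℝ) ≤ 2 * (M * W) := by
    have h1 : T < M * W + W := by
      have := Nat.lt_div_mul_add (a := T) (b := W) (by omega)
      exact this
    have h2 : W ≤ M * W := Nat.le_mul_of_pos_left W hM1
    exact_mod_cast (by omega : T ≤ 2 * (M * W))
  have hπ := Real.pi_lt_four
  -- Taking `δ = e / 8` and `π < 4` makes the probability `e - π δ` of a central start at least `e /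
  -- 2`.
  have hblock : ∀ b < M, e / 8 / 6400 * (e / 2) ≤ ∑ i ∈ Finset.range W,
      ∫ s, (walk ε s (b * W + i) - revenueAt A (walk ε s) (b * W + i)) ∂coinFlips := by
    intro b hb
    refine le_integral_window_walk A hε (by positivity) hk0 hn hkε ?_
    have hbT : ((b * W : ℕ) : ℝ) ≤ T := by
      exact_mod_cast (Nat.mul_le_mul_right W hb.le).trans hMW
    have := walk_central_probability hε (by linarith) (t := b * W) (K := K) (δ := e / 8)
      (le_trans (by gcongr) hTK) (by positivity)
    refine le_trans ?_ this
    rw [← he]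
    nlinarith
  have hsum := nat_mul_le_sum_range_mul
    (f := fun t => ∫ s, (walk ε s t - revenueAt A (walk ε s) t) ∂coinFlips) M hblock
  have hmono : ∑ t ∈ Finset.range (M * W),
        ∫ s, (walk ε s t - revenueAt A (walk ε s) t) ∂coinFlips
      ≤ ∑ t ∈ Finset.range T, ∫ s, (walk ε s t - revenueAt A (walk ε s) t) ∂coinFlips := by
    refine Finset.sum_le_sum_of_subset_of_nonneg (Finset.range_mono hMW) fun t _ _ => ?_
    exact integral_nonneg fun s => sub_nonneg.2 (revenueAt_le A (walk_mem_Icc hε s t).1)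
  have hfin : ∫ s, revenueLoss A (walk ε s) T ∂coinFlips = (1 / (T : ℝ)) * ∑ t ∈ Finset.range T,
      ∫ s, (walk ε s t - revenueAt A (walk ε s) t) ∂coinFlips :=
    (isStochasticBuyer_walk hε).integral_revenueLoss A T
  rw [hfin, one_div, le_inv_mul_iff₀ hT0]
  refine le_trans ?_ (hsum.trans hmono)
  have hWu : (W : ℝ) * u ^ 2 ≤ 1 := by rw [← hXu]; gcongr
  have h0 : (0 : ℝ) ≤ e ^ 2 / 204800 * u ^ 2 := by positivity
  calc (T : ℝ) * (e ^ 2 / 204800 * u ^ 2)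
      ≤ 2 * (M * W) * (e ^ 2 / 204800 * u ^ 2) := by gcongr
    _ = 2 * M * (e ^ 2 / 204800) * (W * u ^ 2) := by ring
    _ ≤ 2 * M * (e ^ 2 / 204800) * 1 := by gcongr
    _ = M * (e / 8 / 6400 * (e / 2)) := by ring

/-- The lower bound for randomized sellers. -/
lemma le_integral_revenueLoss_prod {ε c : ℝ} (hε : 0 < ε) {T : ℕ}
    (hc : ∀ A : Seller, c ≤ ∫ s, revenueLoss A (walk ε s) T ∂coinFlips)
    {Θ : Type*} [MeasurableSpace Θ] (ν : Measure Θ) [IsProbabilityMeasure ν] (A : Θ → Seller)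
    (hA : ∀ h : List Bool, Measurable fun θ => A θ h) :
    c ≤ ∫ x, revenueLoss (A x.1) (walk ε x.2) T ∂(ν.prod coinFlips) := by
  have hint : Integrable (fun x : Θ × (ℕ → Bool) => revenueLoss (A x.1) (walk ε x.2) T)
      (ν.prod coinFlips) :=
    integrable_revenueLoss (A := fun x : Θ × (ℕ → Bool) => A x.1)
      (x := fun t x => walk ε x.2 t) (fun h => (hA h).comp measurable_fst)
      (fun t => (measurable_walk ε t).comp measurable_snd)
      (fun t => ae_of_all _ fun x => walk_mem_Icc hε x.2 t) T
  rw [integral_prod _ hint]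
  calc c = ∫ _, c ∂ν := by simp
    _ ≤ _ := integral_mono (integrable_const c) hint.integral_prod_left fun θ => hc (A θ)

end DynamicPricing

theorem mainTheorem6 :
    -- the algorithm has revenue loss `Õ(ε ^ (2/3))`
    (∃ (C : ℝ) (k : ℕ) (g : ℕ → ℝ), 0 < C ∧ Tendsto g atTop (𝓝 0) ∧
      ∀ ε : ℝ, 0 < ε → ε ≤ 1 → ∀ T : ℕ, 1 ≤ T →
        ∀ (Ω : Type*) (mΩ : MeasurableSpace Ω) (P : Measure Ω) [IsProbabilityMeasure P]
          (ℱ : Filtration ℕ mΩ) (v : ℕ → Ω → ℝ),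
          DynamicPricing.IsStochasticBuyer P ℱ ε v →
          (∀ A : DynamicPricing.Seller,
            Integrable (fun ω => DynamicPricing.revenueLoss A (fun t => v t ω) T) P) ∧
          ∫ ω, DynamicPricing.revenueLoss (DynamicPricing.phaseAlgorithm ε)
              (fun t => v t ω) T ∂P
            ≤ C * (1 + Real.log (1 / ε)) ^ k * (ε ^ (2 / 3 : ℝ) + 1 / (T : ℝ)) ∧
          ∫ ω, DynamicPricing.revenueLoss (DynamicPricing.phaseAlgorithm (max ε (1 / (T : ℝ))))
              (fun t => v t ω) T ∂P
            ≤ C * (1 + Real.log (1 / ε)) ^ k * ε ^ (2 / 3 : ℝ) + g T) ∧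
    -- no online algorithm, randomized or not, has revenue loss less than `Ω(ε ^ (2/3))`
    (∀ K : ℝ, 0 < K → ∃ (c : ℝ) (ε₀ : ℝ), 0 < c ∧ 0 < ε₀ ∧
      ∀ ε : ℝ, 0 < ε → ε ≤ ε₀ →
        (∃ ℱ : Filtration ℕ (MeasurableSpace.pi : MeasurableSpace (ℕ → Bool)),
          DynamicPricing.IsStochasticBuyer DynamicPricing.coinFlips ℱ ε
            (fun t s => DynamicPricing.walk ε s t)) ∧
        ∀ T : ℕ, ε ^ (-(2 / 3) : ℝ) ≤ (T : ℝ) → (T : ℝ) ≤ K * ε ^ (-2 : ℝ) →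
          ∀ (Θ : Type*) (mΘ : MeasurableSpace Θ) (ν : Measure Θ) [IsProbabilityMeasure ν]
            (A : Θ → DynamicPricing.Seller),
            (∀ h : List Bool, Measurable fun θ => A θ h) →
            c * ε ^ (2 / 3 : ℝ) ≤
              ∫ x, DynamicPricing.revenueLoss (A x.1) (DynamicPricing.walk ε x.2) T
                ∂(ν.prod DynamicPricing.coinFlips)) := by
  refine ⟨⟨2 * (15 + Real.exp 6), 1, fun T => (15 + Real.exp 6) * (1 + Real.log T)
      * ((T : ℝ) ^ (-(2 / 3) : ℝ) + 1 / T), by positivity,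
      DynamicPricing.tendsto_log_mul_rpow_add_inv _, ?_⟩, ?_⟩
  · intro ε hε hε1 T hT Ω mΩ P _ ℱ v hv
    simp only [pow_one]
    refine ⟨fun A => hv.integrable_revenueLoss A T,
      (hv.integral_phaseAlgorithm_le hε hε1 hT).trans ?_,
      hv.integral_phaseAlgorithm_max_le hε hε1 hT⟩
    have hL : 0 ≤ Real.log (1 / ε) := Real.log_nonneg (by rw [le_div_iff₀ hε]; linarith)
    gcongr
    linarith [Real.exp_pos 6]
  · intro K _
    refine ⟨Real.exp (-10 * K) ^ 2 / 204800, min (1 / 8) ((Real.exp (-10 * K) / 16) ^ 3),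
      by positivity, by positivity, fun ε hε hε0 => ?_⟩
    refine ⟨⟨_, DynamicPricing.isStochasticBuyer_walk hε⟩, fun T hT1 hT2 Θ _ ν _ A hA => ?_⟩
    exact DynamicPricing.le_integral_revenueLoss_prod hε
      (DynamicPricing.le_integral_revenueLoss_walk hε (hε0.trans (min_le_left _ _))
        (hε0.trans (min_le_right _ _)) hT1 hT2) ν A hA
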